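/- Let $d\ge 2$ be a fixed integer. The $d$-process on $n$ labelled vertices starts from the empty graph and adds edges one at a time; each new edge is chosen uniformly at random among all pairs of distinct, non-adjacent vertices both of whose current degrees are less than $d$, and the process stops when no such pair exists. Call a vertex unsaturated if its current degree is less than $d$, and define the deficit of the process, when the graph has $s$ edges, as $\lfloor dn/2\rfloor - s$. Then for every fixed $\varepsilon>0$, the probability that, at every time of the process at which the deficit is at most $\lfloor \log^{1-\varepsilon} n\rfloor$ (that is, from the moment the deficit reaches this value onwards), the current graph contains no edge joining two unsaturated vertices tends to $1$ as $n\to\infty$ (where $\log$ is the natural logarithm). -/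

import Mathlib

namespace BoundedDegree

open scoped Classical in
/-- The pairs of vertices that the `d`-process may add to `G`: the unused pairs of distinct
vertices which both have current degree less than `d`. -/
noncomputable def available (d : ℕ) {n : ℕ} (G : SimpleGraph (Fin n)) :
    Finset (Sym2 (Fin n)) :=
  Finset.univ.filter fun e => ¬ e.IsDiag ∧ e ∉ G.edgeSet ∧ ∀ v ∈ e, G.degree v < d

/-- The graph on `n` vertices formed by a list of edges. -/
def graphOf {n : ℕ} (l : List (Sym2 (Fin n))) : SimpleGraph (Fin n) :=
  SimpleGraph.fromEdgeSet {e | e ∈ l}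

open scoped Classical in
/-- One step of the `d`-process: append an available edge chosen uniformly at random to the list
`l` of the edges added so far (in chronological order); if there is none, the process is stuck
and nothing changes. -/
noncomputable def step (d : ℕ) {n : ℕ} (l : List (Sym2 (Fin n))) :
    PMF (List (Sym2 (Fin n))) :=
  if h : (available d (graphOf l)).Nonempty then
    (PMF.uniformOfFinset (available d (graphOf l)) h).map fun e => l ++ [e]
  else PMF.pure l

/-- The law of the sequence of edges added by the `d`-process on `n` vertices during its first
`k` steps, starting from the empty graph. -/
noncomputable def run (d n : ℕ) : ℕ → PMF (List (Sym2 (Fin n)))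
  | 0 => PMF.pure []
  | k + 1 => (run d n k).bind (step d)

/-- The law of the complete sequence of edges added by the `d`-process on `n` vertices. The
process is stuck after at most `⌊d n / 2⌋` steps, because all degrees are at most `d`. -/
noncomputable def edgeSequence (d n : ℕ) : PMF (List (Sym2 (Fin n))) :=
  run d n (d * n / 2)

open scoped Classical in
/-- The deficit: `⌊d n / 2⌋` minus the number of edges. (The subtraction never truncates on
graphs of maximum degree at most `d`.) -/
noncomputable def deficit (d : ℕ) {n : ℕ} (G : SimpleGraph (Fin n)) : ℕ :=
  d * n / 2 - G.edgeFinset.card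

open scoped Classical in
/-- The graph has an edge both of whose endpoints are unsaturated, i.e. of degree less
than `d`. -/
def HasUnsaturatedEdge (d : ℕ) {n : ℕ} (G : SimpleGraph (Fin n)) : Prop :=
  ∃ u v, G.Adj u v ∧ G.degree u < d ∧ G.degree v < d

/-- The event that no graph `G_s` of the process (the graph formed by the first `s` edges) whose
deficit is at most `t` has an unsaturated edge. -/
def noUnsaturatedEdgeFrom (d n t : ℕ) : Set (List (Sym2 (Fin n))) :=
  {l | ∀ s ≤ l.length, deficit d (graphOf (l.take s)) ≤ t →
    ¬ HasUnsaturatedEdge d (graphOf (l.take s))}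

end BoundedDegree

/-! Let `X k = excess d G k` be the number of free places beyond the `k`-th at each vertex. Then `X
0 = D` drops by 2 with each edge, so it is deterministic until almost the end, and `X k - X (k + 1)`
counts the vertices with more than `k` free places. Each of the `U` unsaturated vertices is hit with
probability about `2 / U`, so in mean one step sends `X k` to about `(1 - h) * (X k + g * X (k +
1))` with `h = 2 / U`, `g = 2 / (U - 2)`. Weights that are polynomials in the remaining time `r = T
- clock` can follow this linear flow. With `beta` of degree `k - 1` in the numerator and `alpha` of
degree `k` in the denominator, the quotient `upperSum / lowerSum` is a supermartingale up to errors
of order `polylog / D ^ 2` (`mean_ratio_le`). It starts at order `1 / T` because of the difference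
in degree, where `T = log n / 4`. When `r` drops below 2 it is replaced by `latePotential`, an exact
supermartingale (`mean_latePotential_le`). Hence late in the process the mean of `X 1` is `O(D / log
n)` plus a negligible term (`runMean_excess_one_le`).

Let `W` count the ordered adjacent unsaturated pairs. A pair whose ends have one free place each is
destroyed at rate about `4 / D`; other pairs, and the creation of pairs, cost `O(X 1 / D)`
(`mean_unsatPairs_le`). Since `D` falls only at rate `2 / D`, old pairs die out faster than `D`, so
the mean of `W` is `O(D / log n)` plus a negligible term too (`runMean_card_unsatPairs_le`).

At deficit `t = ⌊log^(1-ε) n⌋` one has `D ≤ 2 * t + 1 = o(log n)`, so by Markov's inequality `X 1 =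
0` and `W = 0` with probability tending to 1. That state is absorbing (`settled_append`): every
later edge saturates both its ends. -/

namespace BoundedDegree

section

open scoped Classical

variable {n : ℕ}

/-! ### Free places and the effect of one edge on them -/

/-- The number of further edges that the vertex `v` can receive. -/
noncomputable def free (d : ℕ) (G : SimpleGraph (Fin n)) (v : Fin n) : ℕ := d - G.degree v

/-- The vertices which can receive more than `k` further edges. -/
noncomputable def freeAbove (d : ℕ) (G : SimpleGraph (Fin n)) (k : ℕ) : Finset (Fin n) :=
  Finset.univ.filter fun v => k < free d G v

/-- The total number of free places beyond the `k`-th, over all vertices. -/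
noncomputable def excess (d : ℕ) (G : SimpleGraph (Fin n)) (k : ℕ) : ℝ :=
  ∑ v, ((free d G v - k : ℕ) : ℝ)

/-- The number of endpoints of `e` which can receive more than `k` further edges. -/
noncomputable def hit (d : ℕ) (G : SimpleGraph (Fin n)) (k : ℕ) (e : Sym2 (Fin n)) : ℕ :=
  ((freeAbove d G k).filter fun w => w ∈ e).card

/-- The number of available pairs that contain `w`. -/
noncomputable def choices (d : ℕ) (G : SimpleGraph (Fin n)) (w : Fin n) : ℕ :=
  ((available d G).filter fun e => w ∈ e).card

/-- The number of unsaturated vertices. -/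
noncomputable def numUnsat (d : ℕ) (G : SimpleGraph (Fin n)) : ℕ := (freeAbove d G 0).card

theorem mem_freeAbove {d : ℕ} {G : SimpleGraph (Fin n)} {k : ℕ} {v : Fin n} :
    v ∈ freeAbove d G k ↔ k < free d G v := by simp [freeAbove]

theorem free_pos_iff {d : ℕ} {G : SimpleGraph (Fin n)} {v : Fin n} :
    0 < free d G v ↔ G.degree v < d := by simp [free]

theorem free_le (d : ℕ) (G : SimpleGraph (Fin n)) (v : Fin n) : free d G v ≤ d := by
  simp [free]

theorem excess_nonneg (d : ℕ) (G : SimpleGraph (Fin n)) (k : ℕ) : 0 ≤ excess d G k :=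
  Finset.sum_nonneg fun _ _ => Nat.cast_nonneg _

theorem excess_self (d : ℕ) (G : SimpleGraph (Fin n)) : excess d G d = 0 := by
  refine Finset.sum_eq_zero fun v _ => ?_
  have := free_le d G v
  simp [Nat.sub_eq_zero_of_le this]

/-- This identity closes the system: the mean loss of `excess d G k` is proportional to this
cardinality, hence linear in the excesses. -/
theorem excess_eq_add_card (d : ℕ) (G : SimpleGraph (Fin n)) (k : ℕ) :
    excess d G k = excess d G (k + 1) + (freeAbove d G k).card := by
  rw [freeAbove, Finset.card_filter]
  push_cast
  rw [excess, excess, ← Finset.sum_add_distrib]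
  refine Finset.sum_congr rfl fun v _ => ?_
  split_ifs with h
  · have : free d G v - k = (free d G v - (k + 1)) + 1 := by omega
    rw [this]; push_cast; ring
  · have h1 : free d G v - k = 0 := by omega
    have h2 : free d G v - (k + 1) = 0 := by omega
    simp [h1, h2]

theorem excess_antitone (d : ℕ) (G : SimpleGraph (Fin n)) : Antitone (excess d G) := by
  refine antitone_nat_of_succ_le fun k => ?_
  rw [excess_eq_add_card d G k]
  linarith [Nat.cast_nonneg (α := ℝ) (freeAbove d G k).card]

theorem freeAbove_subset (d : ℕ) (G : SimpleGraph (Fin n)) (k : ℕ) :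
    freeAbove d G k ⊆ freeAbove d G 0 := by
  intro v
  simp only [mem_freeAbove]
  omega

theorem card_freeAbove_le (d : ℕ) (G : SimpleGraph (Fin n)) (k : ℕ) :
    (freeAbove d G k).card ≤ numUnsat d G :=
  Finset.card_le_card (freeAbove_subset d G k)

theorem excess_zero_le (d : ℕ) (G : SimpleGraph (Fin n)) :
    excess d G 0 ≤ d * numUnsat d G := by
  rw [excess, numUnsat, ← Finset.sum_filter_add_sum_filter_not Finset.univ
    (fun v => 0 < free d G v)]
  have h2 : ∑ v ∈ Finset.univ.filter (fun v => ¬ 0 < free d G v),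
      ((free d G v - 0 : ℕ) : ℝ) = 0 := by
    refine Finset.sum_eq_zero fun v hv => ?_
    have : free d G v = 0 := by simpa using hv
    simp [this]
  rw [h2, add_zero, freeAbove, mul_comm, ← nsmul_eq_mul]
  refine Finset.sum_le_card_nsmul _ _ _ fun v _ => ?_
  exact_mod_cast free_le d G v

theorem numUnsat_le_excess (d : ℕ) (G : SimpleGraph (Fin n)) :
    (numUnsat d G : ℝ) ≤ excess d G 0 := by
  rw [excess_eq_add_card]
  have := excess_nonneg d G 1
  simp only [numUnsat]
  simpa using this

theorem card_freeAbove_le_excess (d : ℕ) (G : SimpleGraph (Fin n)) (k : ℕ) :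
    ((freeAbove d G k).card : ℝ) ≤ excess d G k := by
  rw [excess_eq_add_card]
  linarith [excess_nonneg d G (k + 1)]

theorem mem_available {d : ℕ} {G : SimpleGraph (Fin n)} {u v : Fin n} :
    s(u, v) ∈ available d G ↔ u ≠ v ∧ ¬ G.Adj u v ∧ 0 < free d G u ∧ 0 < free d G v := by
  simp [available, free]

theorem graphOf_append (l : List (Sym2 (Fin n))) (e : Sym2 (Fin n)) :
    graphOf (l ++ [e]) = graphOf l ⊔ SimpleGraph.fromEdgeSet {e} := by
  ext u v
  simp only [graphOf, SimpleGraph.sup_adj, SimpleGraph.fromEdgeSet_adj, Set.mem_ofPred_eq,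
    List.mem_append, List.mem_singleton, Set.mem_singleton_iff]
  tauto

theorem degree_eq_of_eq_sup {d : ℕ} {G G' : SimpleGraph (Fin n)} {e : Sym2 (Fin n)}
    (he : e ∈ available d G) (hG' : G' = G ⊔ SimpleGraph.fromEdgeSet {e}) (w : Fin n) :
    G'.degree w = G.degree w + if w ∈ e then 1 else 0 := by
  induction e with | h a b =>
  obtain ⟨hab, hadj, -, -⟩ := mem_available.1 he
  rw [← SimpleGraph.card_neighborFinset_eq_degree, ← SimpleGraph.card_neighborFinset_eq_degree]
  by_cases hwa : w = a
  · subst hwa hG'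
    rw [if_pos (by simp), ← Finset.card_insert_of_notMem (a := b) (by simpa using hadj)]
    congr 1
    ext x
    simp only [SimpleGraph.mem_neighborFinset, SimpleGraph.sup_adj,
      SimpleGraph.fromEdgeSet_adj, Set.mem_singleton_iff, Finset.mem_insert, Sym2.eq_iff]
    grind
  · by_cases hwb : w = b
    · subst hwb hG'
      have hadj' : ¬ G.Adj w a := fun h => hadj h.symm
      rw [if_pos (by simp), ← Finset.card_insert_of_notMem (a := a) (by simpa using hadj')]
      congr 1
      ext x
      simp only [SimpleGraph.mem_neighborFinset, SimpleGraph.sup_adj,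
        SimpleGraph.fromEdgeSet_adj, Set.mem_singleton_iff, Finset.mem_insert, Sym2.eq_iff]
      grind
    · subst hG'
      rw [if_neg (by simp [hwa, hwb]), add_zero]
      congr 1
      ext x
      simp only [SimpleGraph.mem_neighborFinset, SimpleGraph.sup_adj,
        SimpleGraph.fromEdgeSet_adj, Set.mem_singleton_iff, Sym2.eq_iff]
      grind

theorem free_sup_fromEdgeSet {d : ℕ} {G : SimpleGraph (Fin n)} {e : Sym2 (Fin n)}
    (he : e ∈ available d G) (w : Fin n) :
    free d (G ⊔ SimpleGraph.fromEdgeSet {e}) w = free d G w - if w ∈ e then 1 else 0 := by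
  rw [free, free, degree_eq_of_eq_sup he rfl, Nat.sub_add_eq]

theorem free_pos_of_mem {d : ℕ} {G : SimpleGraph (Fin n)} {e : Sym2 (Fin n)}
    (he : e ∈ available d G) {w : Fin n} (hw : w ∈ e) : 0 < free d G w := by
  rw [free_pos_iff]
  have := (Finset.mem_filter.1 he).2.2.2 w hw
  exact this

theorem excess_sup_fromEdgeSet {d : ℕ} {G : SimpleGraph (Fin n)} {e : Sym2 (Fin n)}
    (he : e ∈ available d G) (k : ℕ) :
    excess d (G ⊔ SimpleGraph.fromEdgeSet {e}) k = excess d G k - hit d G k e := by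
  rw [hit, freeAbove, Finset.filter_filter, Finset.card_filter]
  push_cast
  rw [excess, excess, ← Finset.sum_sub_distrib]
  refine Finset.sum_congr rfl fun v _ => ?_
  rw [free_sup_fromEdgeSet he]
  by_cases hv : v ∈ e
  · by_cases hk : k < free d G v
    · have : free d G v - k = (free d G v - 1 - k) + 1 := by omega
      simp only [hv, hk, if_true, and_self, this]
      push_cast; ring
    · have h1 : free d G v - k = 0 := by omega
      have h2 : free d G v - 1 - k = 0 := by omega
      simp [hv, hk, h1, h2]
  · simp [hv]

theorem hit_zero {d : ℕ} {G : SimpleGraph (Fin n)} {e : Sym2 (Fin n)}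
    (he : e ∈ available d G) : hit d G 0 e = 2 := by
  induction e with | h a b =>
  obtain ⟨hab, -, ha, hb⟩ := mem_available.1 he
  rw [hit, ← Finset.card_pair hab]
  congr 1
  ext x
  simp only [Finset.mem_filter, mem_freeAbove, Sym2.mem_iff, Finset.mem_insert,
    Finset.mem_singleton]
  grind

theorem hit_le_two {d : ℕ} {G : SimpleGraph (Fin n)} {e : Sym2 (Fin n)}
    (he : e ∈ available d G) (k : ℕ) : hit d G k e ≤ 2 := by
  rw [← hit_zero he]
  exact Finset.card_le_card (Finset.filter_subset_filter _ (freeAbove_subset d G k))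

theorem sum_hit (d : ℕ) (G : SimpleGraph (Fin n)) (k : ℕ) :
    ∑ e ∈ available d G, hit d G k e = ∑ w ∈ freeAbove d G k, choices d G w := by
  simp only [hit, choices]
  exact (Finset.sum_card_bipartiteAbove_eq_sum_card_bipartiteBelow (fun w e => w ∈ e)).symm

theorem choices_eq (d : ℕ) (G : SimpleGraph (Fin n)) {w : Fin n} (hw : 0 < free d G w) :
    choices d G w = (((freeAbove d G 0).erase w).filter fun v => ¬ G.Adj w v).card := by
  rw [choices]
  symm
  refine Finset.card_bij (fun v _ => s(w, v)) ?_ ?_ ?_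
  · intro v hv
    simp only [Finset.mem_filter, Finset.mem_erase, mem_freeAbove] at hv
    simp only [Finset.mem_filter, mem_available, Sym2.mem_iff, true_or, and_true]
    exact ⟨Ne.symm hv.1.1, hv.2, hw, hv.1.2⟩
  · intro v _ v' _ h
    exact Sym2.congr_right.1 h
  · intro e he
    obtain ⟨he, hwe⟩ := Finset.mem_filter.1 he
    obtain ⟨v, rfl⟩ := Sym2.mem_iff_exists.1 hwe
    obtain ⟨h1, h2, -, h4⟩ := mem_available.1 he
    refine ⟨v, ?_, rfl⟩
    simp only [Finset.mem_filter, Finset.mem_erase, mem_freeAbove]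
    exact ⟨⟨Ne.symm h1, h4⟩, h2⟩

theorem choices_add_one_le (d : ℕ) (G : SimpleGraph (Fin n)) {w : Fin n}
    (hw : 0 < free d G w) : choices d G w + 1 ≤ numUnsat d G := by
  rw [choices_eq d G hw, numUnsat, ← Finset.card_erase_add_one (mem_freeAbove.2 hw)]
  exact Nat.add_le_add_right (Finset.card_le_card (Finset.filter_subset _ _)) 1

/-- The loss `d` consists of `w` itself and its at most `d - 1` neighbours. -/
theorem numUnsat_le_choices_add (d : ℕ) (G : SimpleGraph (Fin n)) {w : Fin n}
    (hw : 0 < free d G w) : numUnsat d G ≤ choices d G w + d := by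
  rw [choices_eq d G hw, numUnsat, ← Finset.card_erase_add_one (mem_freeAbove.2 hw)]
  have h1 := Finset.card_filter_add_card_filter_not (s := (freeAbove d G 0).erase w)
    (fun v => G.Adj w v)
  have h2 : (((freeAbove d G 0).erase w).filter fun v => G.Adj w v).card ≤ G.degree w := by
    rw [← SimpleGraph.card_neighborFinset_eq_degree]
    refine Finset.card_le_card fun v hv => ?_
    simpa using (Finset.mem_filter.1 hv).2
  have h3 := free_pos_iff.1 hw
  omega

theorem sum_hit_le (d : ℕ) (G : SimpleGraph (Fin n)) (k : ℕ) :
    ∑ e ∈ available d G, (hit d G k e : ℝ) ≤ (freeAbove d G k).card * (numUnsat d G - 1) := by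
  have h := sum_hit d G k
  have h' : ∑ e ∈ available d G, (hit d G k e : ℝ) = ∑ w ∈ freeAbove d G k, (choices d G w : ℝ) := by
    exact_mod_cast h
  rw [h', ← nsmul_eq_mul]
  refine Finset.sum_le_card_nsmul _ _ _ fun w hw => ?_
  have := choices_add_one_le d G (w := w) (by have := mem_freeAbove.1 hw; omega)
  have : (choices d G w : ℝ) + 1 ≤ numUnsat d G := by exact_mod_cast this
  linarith

theorem le_sum_hit (d : ℕ) (G : SimpleGraph (Fin n)) (k : ℕ) :
    (freeAbove d G k).card * ((numUnsat d G : ℝ) - d) ≤ ∑ e ∈ available d G, (hit d G k e : ℝ) := by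
  have h := sum_hit d G k
  have h' : ∑ e ∈ available d G, (hit d G k e : ℝ) = ∑ w ∈ freeAbove d G k, (choices d G w : ℝ) := by
    exact_mod_cast h
  rw [h', ← nsmul_eq_mul]
  refine Finset.card_nsmul_le_sum _ _ _ fun w hw => ?_
  have := numUnsat_le_choices_add d G (w := w) (by have := mem_freeAbove.1 hw; omega)
  have : (numUnsat d G : ℝ) ≤ choices d G w + d := by exact_mod_cast this
  linarith

theorem sum_hit_zero (d : ℕ) (G : SimpleGraph (Fin n)) :
    ∑ e ∈ available d G, (hit d G 0 e : ℝ) = 2 * (available d G).card := by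
  rw [Finset.sum_congr rfl (g := fun _ => (2 : ℝ)) fun e he => by rw [hit_zero he]; norm_num]
  simp [mul_comm]

theorem two_mul_card_available_le (d : ℕ) (G : SimpleGraph (Fin n)) :
    2 * ((available d G).card : ℝ) ≤ numUnsat d G * (numUnsat d G - 1) := by
  rw [← sum_hit_zero]
  exact sum_hit_le d G 0

theorem le_two_mul_card_available (d : ℕ) (G : SimpleGraph (Fin n)) :
    (numUnsat d G : ℝ) * (numUnsat d G - d) ≤ 2 * ((available d G).card : ℝ) := by
  rw [← sum_hit_zero]
  exact le_sum_hit d G 0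

/-! ### Adjacent unsaturated vertices -/

/-- The ordered pairs of adjacent unsaturated vertices. -/
noncomputable def unsatPairs (d : ℕ) (G : SimpleGraph (Fin n)) : Finset (Fin n × Fin n) :=
  Finset.univ.filter fun p => G.Adj p.1 p.2 ∧ 0 < free d G p.1 ∧ 0 < free d G p.2

/-- The ordered pairs of adjacent vertices which can receive exactly one further edge. -/
noncomputable def tightPairs (d : ℕ) (G : SimpleGraph (Fin n)) : Finset (Fin n × Fin n) :=
  Finset.univ.filter fun p => G.Adj p.1 p.2 ∧ free d G p.1 = 1 ∧ free d G p.2 = 1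

theorem hasUnsaturatedEdge_iff (d : ℕ) (G : SimpleGraph (Fin n)) :
    HasUnsaturatedEdge d G ↔ (unsatPairs d G).Nonempty := by
  constructor
  · rintro ⟨u, v, h1, h2, h3⟩
    exact ⟨(u, v), by simpa [unsatPairs, free_pos_iff] using ⟨h1, h2, h3⟩⟩
  · rintro ⟨⟨u, v⟩, h⟩
    exact ⟨u, v, by simpa [unsatPairs, free_pos_iff] using h⟩

theorem card_adj_filter_le (d : ℕ) (G : SimpleGraph (Fin n)) (k : ℕ) :
    (Finset.univ.filter fun p : Fin n × Fin n => G.Adj p.1 p.2 ∧ k < free d G p.1).card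
      ≤ d * (freeAbove d G k).card := by
  have hsub : (Finset.univ.filter fun p : Fin n × Fin n => G.Adj p.1 p.2 ∧ k < free d G p.1) ⊆
      ((freeAbove d G k).sigma (fun v => G.neighborFinset v)).map
        (Equiv.sigmaEquivProd (Fin n) (Fin n)).toEmbedding := by
    rintro ⟨u, v⟩ h
    simp only [Finset.mem_filter, Finset.mem_univ, true_and] at h
    simp only [Finset.mem_map_equiv, Finset.mem_sigma, mem_freeAbove,
      SimpleGraph.mem_neighborFinset, Equiv.sigmaEquivProd_symm_apply]
    exact ⟨h.2, h.1⟩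
  refine (Finset.card_le_card hsub).trans ?_
  rw [Finset.card_map, Finset.card_sigma, mul_comm, ← smul_eq_mul]
  refine Finset.sum_le_card_nsmul _ _ _ fun v hv => ?_
  have := mem_freeAbove.1 hv
  have : 0 < free d G v := by omega
  rw [SimpleGraph.card_neighborFinset_eq_degree]
  exact (free_pos_iff.1 this).le

theorem card_unsatPairs_le (d : ℕ) (G : SimpleGraph (Fin n)) :
    (unsatPairs d G).card ≤ d * numUnsat d G := by
  refine le_trans (Finset.card_le_card ?_) (card_adj_filter_le d G 0)
  intro p
  simp only [unsatPairs, Finset.mem_filter]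
  tauto

/-- A pair that is not tight has an end with at least two free places, and such an end has fewer
than `d` neighbours; the factor 2 covers the two orders. -/
theorem card_unsatPairs_le_tightPairs (d : ℕ) (G : SimpleGraph (Fin n)) :
    (unsatPairs d G).card ≤ (tightPairs d G).card + 2 * (d * (freeAbove d G 1).card) := by
  have h1 := card_adj_filter_le d G 1
  set S := Finset.univ.filter fun p : Fin n × Fin n => G.Adj p.1 p.2 ∧ 1 < free d G p.1
  have hsub : unsatPairs d G ⊆ tightPairs d G ∪
      (S ∪ S.map (Equiv.prodComm (Fin n) (Fin n)).toEmbedding) := by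
    rintro ⟨u, v⟩ h
    simp only [unsatPairs, Finset.mem_filter, Finset.mem_univ, true_and] at h
    simp only [S, tightPairs, Finset.mem_union, Finset.mem_map_equiv, Finset.mem_filter,
      Finset.mem_univ, true_and, Equiv.prodComm_symm, Equiv.prodComm_apply, Prod.swap_prod_mk]
    by_cases hu : free d G u = 1
    · by_cases hv : free d G v = 1
      · exact Or.inl ⟨h.1, hu, hv⟩
      · exact Or.inr (Or.inr ⟨h.1.symm, by omega⟩)
    · exact Or.inr (Or.inl ⟨h.1, by omega⟩)
  have h2 := (Finset.card_le_card hsub).trans (Finset.card_union_le _ _)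
  have h3 := Finset.card_union_le S (S.map (Equiv.prodComm (Fin n) (Fin n)).toEmbedding)
  rw [Finset.card_map] at h3
  omega

theorem adj_sup_fromEdgeSet {G : SimpleGraph (Fin n)} {e : Sym2 (Fin n)} {u v : Fin n} :
    (G ⊔ SimpleGraph.fromEdgeSet {e}).Adj u v ↔ G.Adj u v ∨ s(u, v) = e ∧ u ≠ v := by
  simp [SimpleGraph.sup_adj]

/-- A tight pair is lost as soon as `e` hits one of its ends; it cannot hit both, since `e` is not
yet an edge. The only new pairs are the two orders of `e`, and only if both ends keep a free place,
in which case `hit d G 1 e = 2`. -/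
theorem card_unsatPairs_sup_le {d : ℕ} {G : SimpleGraph (Fin n)} {e : Sym2 (Fin n)}
    (he : e ∈ available d G) :
    (unsatPairs d (G ⊔ SimpleGraph.fromEdgeSet {e})).card
      + ((tightPairs d G).filter fun p => p.1 ∈ e).card
      + ((tightPairs d G).filter fun p => p.2 ∈ e).card
      ≤ (unsatPairs d G).card + hit d G 1 e := by
  set G' := G ⊔ SimpleGraph.fromEdgeSet {e} with hG'
  set K1 := (tightPairs d G).filter fun p => p.1 ∈ e with hK1
  set K2 := (tightPairs d G).filter fun p => p.2 ∈ e with hK2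
  set O := (unsatPairs d G').filter fun p => G.Adj p.1 p.2 with hO
  set N := (unsatPairs d G').filter fun p => ¬ G.Adj p.1 p.2 with hN
  have hcard : O.card + N.card = (unsatPairs d G').card :=
    Finset.card_filter_add_card_filter_not _
  have hfree := fun w => free_sup_fromEdgeSet he w
  have hNle : N.card ≤ hit d G 1 e := by
    induction e with | h a b =>
    obtain ⟨hab, hadj, ha, hb⟩ := mem_available.1 he
    have hmem : ∀ p ∈ N, (p = (a, b) ∨ p = (b, a)) ∧ 1 < free d G a ∧ 1 < free d G b := by
      rintro ⟨u, v⟩ hp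
      simp only [hN, unsatPairs, Finset.mem_filter, Finset.mem_univ, true_and, hG',
        adj_sup_fromEdgeSet, hfree, Sym2.mem_iff, Sym2.eq_iff] at hp
      obtain ⟨⟨h1, h2, h3⟩, h4⟩ := hp
      rcases h1 with h1 | ⟨⟨rfl, rfl⟩ | ⟨rfl, rfl⟩, h1⟩
      · exact absurd h1 h4
      · simp at h2 h3 ⊢; omega
      · simp at h2 h3 ⊢; omega
    by_cases hab2 : 1 < free d G a ∧ 1 < free d G b
    · have h2 : hit d G 1 s(a, b) = 2 := by
        rw [hit, ← Finset.card_pair hab]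
        congr 1
        ext x
        simp only [Finset.mem_filter, mem_freeAbove, Sym2.mem_iff, Finset.mem_insert,
          Finset.mem_singleton]
        grind
      rw [h2]
      refine (Finset.card_le_card (t := {(a, b), (b, a)}) fun p hp => ?_).trans
        Finset.card_le_two
      simpa using (hmem p hp).1
    · have : N = ∅ := by
        by_contra hne
        obtain ⟨p, hp⟩ := Finset.nonempty_iff_ne_empty.2 hne
        exact hab2 (hmem p hp).2
      simp [this]
  have hsub1 : O ∪ (K1 ∪ K2) ⊆ unsatPairs d G := by
    rintro ⟨u, v⟩ hp
    simp only [hO, hK1, hK2, unsatPairs, tightPairs, Finset.mem_union, Finset.mem_filter,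
      Finset.mem_univ, true_and, hG', hfree] at hp ⊢
    rcases hp with ⟨⟨h1, h2, h3⟩, h4⟩ | ⟨⟨h1, h2, h3⟩, h4⟩ | ⟨⟨h1, h2, h3⟩, h4⟩
    · exact ⟨h4, by omega, by omega⟩
    · exact ⟨h1, by omega, by omega⟩
    · exact ⟨h1, by omega, by omega⟩
  have hd1 : Disjoint K1 K2 := by
    rw [Finset.disjoint_left]
    rintro ⟨u, v⟩ h1 h2
    simp only [hK1, hK2, tightPairs, Finset.mem_filter, Finset.mem_univ, true_and] at h1 h2
    have : e = s(u, v) := (Sym2.mem_and_mem_iff h1.1.1.ne).1 ⟨h1.2, h2.2⟩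
    subst this
    exact (mem_available.1 he).2.1 h1.1.1
  have hd2 : Disjoint O (K1 ∪ K2) := by
    rw [Finset.disjoint_left]
    rintro ⟨u, v⟩ h1 h2
    simp only [hO, hK1, hK2, tightPairs, unsatPairs, Finset.mem_union, Finset.mem_filter,
      Finset.mem_univ, true_and, hG', hfree] at h1 h2
    obtain ⟨⟨-, h3, h4⟩, -⟩ := h1
    rcases h2 with ⟨⟨-, h5, h6⟩, h7⟩ | ⟨⟨-, h5, h6⟩, h7⟩
    · simp [h5, h7] at h3
    · simp [h6, h7] at h4
  have := Finset.card_le_card hsub1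
  rw [Finset.card_union_of_disjoint hd2, Finset.card_union_of_disjoint hd1] at this
  omega

theorem le_sum_card_tightPairs (d : ℕ) (G : SimpleGraph (Fin n)) (f : Fin n × Fin n → Fin n)
    (hf : ∀ p ∈ tightPairs d G, free d G (f p) = 1) :
    (tightPairs d G).card * ((numUnsat d G : ℝ) - d) ≤
      ∑ e ∈ available d G, (((tightPairs d G).filter fun p => f p ∈ e).card : ℝ) := by
  have h : ∑ e ∈ available d G, ((tightPairs d G).filter fun p => f p ∈ e).card =
      ∑ p ∈ tightPairs d G, choices d G (f p) :=
    (Finset.sum_card_bipartiteAbove_eq_sum_card_bipartiteBelow (fun p e => f p ∈ e)).symm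
  have h' : ∑ e ∈ available d G, (((tightPairs d G).filter fun p => f p ∈ e).card : ℝ) =
      ∑ p ∈ tightPairs d G, (choices d G (f p) : ℝ) := by exact_mod_cast h
  rw [h', ← nsmul_eq_mul]
  refine Finset.card_nsmul_le_sum _ _ _ fun p hp => ?_
  have := numUnsat_le_choices_add d G (w := f p) (by rw [hf p hp]; norm_num)
  have : (numUnsat d G : ℝ) ≤ choices d G (f p) + d := by exact_mod_cast this
  linarith

theorem sum_card_unsatPairs_le (d : ℕ) (G : SimpleGraph (Fin n)) :
    ∑ e ∈ available d G, ((unsatPairs d (G ⊔ SimpleGraph.fromEdgeSet {e})).card : ℝ)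
      ≤ (available d G).card * (unsatPairs d G).card
        - 2 * (tightPairs d G).card * ((numUnsat d G : ℝ) - d)
        + (freeAbove d G 1).card * (numUnsat d G - 1) := by
  have h1 := le_sum_card_tightPairs d G Prod.fst fun p hp => by
    simp only [tightPairs, Finset.mem_filter] at hp; exact hp.2.2.1
  have h2 := le_sum_card_tightPairs d G Prod.snd fun p hp => by
    simp only [tightPairs, Finset.mem_filter] at hp; exact hp.2.2.2
  have h3 := sum_hit_le d G 1
  have h4 : ∑ e ∈ available d G, (((unsatPairs d (G ⊔ SimpleGraph.fromEdgeSet {e})).card : ℝ)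
      + ((tightPairs d G).filter fun p => p.1 ∈ e).card
      + ((tightPairs d G).filter fun p => p.2 ∈ e).card) ≤
      ∑ e ∈ available d G, (((unsatPairs d G).card : ℝ) + hit d G 1 e) :=
    Finset.sum_le_sum fun e he => by exact_mod_cast card_unsatPairs_sup_le he
  simp only [Finset.sum_add_distrib, Finset.sum_const, nsmul_eq_mul] at h4
  linarith

/-! ### Weights following the linear flow, and quotients of weighted sums -/

/-- Summation by parts for weights that decrease along the flow `X k ↦ X k + g * X (k + 1)`. -/
theorem sum_shift_le {d : ℕ} {X w w' : ℕ → ℝ} {g : ℝ} (hX : ∀ k, 0 ≤ X k) (hXd : X d = 0)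
    (h0 : w' 0 ≤ w 0) (hw : ∀ k, w' (k + 1) + g * w' k ≤ w (k + 1)) :
    ∑ k ∈ Finset.range d, w' k * (X k + g * X (k + 1)) ≤ ∑ k ∈ Finset.range d, w k * X k := by
  -- The boundary term `w' m * X m` makes the induction close; it vanishes at `m = d`.
  have key : ∀ m, ∑ k ∈ Finset.range m, w' k * (X k + g * X (k + 1)) + w' m * X m ≤
      ∑ k ∈ Finset.range (m + 1), w k * X k := by
    intro m
    induction m with
    | zero => simpa using mul_le_mul_of_nonneg_right h0 (hX 0)
    | succ m ih =>
      rw [Finset.sum_range_succ, Finset.sum_range_succ _ (m + 1)]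
      have := mul_le_mul_of_nonneg_right (hw m) (hX (m + 1))
      nlinarith
  have := key d
  rwa [hXd, mul_zero, add_zero, Finset.sum_range_succ, hXd, mul_zero, add_zero] at this

/-- The weights of the denominator. -/
noncomputable def alpha (k : ℕ) (r : ℝ) : ℝ := (r / 2) ^ k / k.factorial

/-- The weights of the numerator. -/
noncomputable def beta : ℕ → ℝ → ℝ
  | 0, _ => 0
  | k + 1, y => y ^ k

theorem alpha_zero (r : ℝ) : alpha 0 r = 1 := by simp [alpha]

theorem alpha_nonneg (k : ℕ) {r : ℝ} (hr : 0 ≤ r) : 0 ≤ alpha k r := by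
  unfold alpha; positivity

theorem beta_nonneg (k : ℕ) {y : ℝ} (hy : 0 ≤ y) : 0 ≤ beta k y := by
  cases k <;> simp only [beta] <;> positivity

theorem alpha_le {k d : ℕ} (hk : k ≤ d) {r y : ℝ} (hr : 0 ≤ r) (hry : r ≤ y) (hy : 1 ≤ y) :
    alpha k r ≤ y ^ d := by
  have h1 : alpha k r ≤ (r / 2) ^ k :=
    div_le_self (by positivity) (by exact_mod_cast Nat.one_le_iff_ne_zero.2 k.factorial_ne_zero)
  refine h1.trans ((pow_le_pow_left₀ (by positivity) (by linarith) k).trans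
    (pow_le_pow_right₀ hy hk))

theorem beta_le {k d : ℕ} (hk : k ≤ d) {y z : ℝ} (hy : 0 ≤ y) (hyz : y ≤ z) (hz : 1 ≤ z) :
    beta k y ≤ z ^ d := by
  cases k with
  | zero => simp only [beta]; positivity
  | succ k =>
    exact (pow_le_pow_left₀ hy hyz k).trans (pow_le_pow_right₀ hz (by omega))

theorem beta_mono (k : ℕ) {y z : ℝ} (hy : 0 ≤ y) (hyz : y ≤ z) : beta k y ≤ beta k z := by
  cases k with
  | zero => simp [beta]
  | succ k => exact pow_le_pow_left₀ hy hyz k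

/-- The derivative of `alpha (k + 1)` is only half of `alpha k`; the spare half absorbs the
higher-order terms in `g`, which needs `r` bounded below and `d * g` small. -/
theorem alpha_add_le {d k : ℕ} (hk : k < d) {r g : ℝ} (hr : 1 ≤ r) (hg : 0 ≤ g)
    (hgd : 2 * d * g ≤ 1) :
    alpha (k + 1) (r + g) ≤ alpha (k + 1) r + g * alpha k r := by
  have hz : 0 ≤ g / r := by positivity
  have hzg : g / r ≤ g := div_le_self hg hr
  have key : ∀ m ≤ d, (1 + g / r) ^ m ≤ 1 + 2 * m * (g / r) := by
    intro m
    induction m with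
    | zero => simp
    | succ m ih =>
      intro hm
      have hm' : (m : ℝ) ≤ d := by exact_mod_cast (Nat.le_of_succ_le hm)
      have h1 : 2 * (m : ℝ) * (g / r) ≤ 1 :=
        (mul_le_mul (by linarith) hzg hz (by positivity)).trans hgd
      rw [pow_succ]
      have h2 := mul_le_mul_of_nonneg_right (ih (by omega)) (by linarith : 0 ≤ 1 + g / r)
      push_cast
      nlinarith [mul_nonneg hz (sub_nonneg.2 h1)]
  have h1 := key (k + 1) (by omega)
  have h2 : (r + g) / 2 = (r / 2) * (1 + g / r) := by field_simp
  simp only [alpha]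
  rw [h2, mul_pow]
  have h3 : (r / 2) ^ (k + 1) * (1 + g / r) ^ (k + 1) ≤
      (r / 2) ^ (k + 1) * (1 + 2 * (k + 1 : ℕ) * (g / r)) :=
    mul_le_mul_of_nonneg_left h1 (by positivity)
  refine (div_le_div_of_nonneg_right h3 (by positivity)).trans (le_of_eq ?_)
  rw [Nat.factorial_succ]
  push_cast
  field_simp
  ring

/-- For the numerator the inequality goes the other way, and `y ^ k * (y + g) ≤ (y + g) ^ (k + 1)`
suffices. -/
theorem beta_add_le (k : ℕ) {y g : ℝ} (hy : 0 ≤ y) (hg : 0 ≤ g) :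
    beta (k + 1) y + g * beta k y ≤ beta (k + 1) (y + g) := by
  cases k with
  | zero => simp [beta]
  | succ k =>
    simp only [beta]
    have h1 : y ^ k ≤ (y + g) ^ k := pow_le_pow_left₀ hy (by linarith) k
    rw [pow_succ, pow_succ]
    nlinarith [mul_le_mul_of_nonneg_right h1 (by linarith : 0 ≤ y + g)]

/-- One random step changes the mean of a ratio of two weighted sums only in second order, if
the weights follow the drift. -/
theorem sum_ratio_le {ι : Type*} {P : Finset ι} (hP : P.Nonempty) {d : ℕ} {X : ℕ → ℝ}
    {δ : ι → ℕ → ℝ} {a a' b b' : ℕ → ℝ} {h g κ M ρ : ℝ}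
    (hX : ∀ k, 0 ≤ X k) (hXd : X d = 0) (hX0 : 2 < X 0)
    (hN0 : ∀ k, 0 ≤ X k - X (k + 1)) (hN : ∀ k, h * (X k - X (k + 1)) ≤ 2)
    (hh0 : 0 ≤ h) (hh1 : h ≤ 1) (hg : (1 - h) * g = h)
    (hδ0 : ∀ e ∈ P, ∀ k, 0 ≤ δ e k) (hδ2 : ∀ e ∈ P, ∀ k, δ e k ≤ 2)
    (hδX : ∀ e ∈ P, ∀ k, δ e k ≤ X k)
    (hκ : ∀ k, |h * (X k - X (k + 1)) - (∑ e ∈ P, δ e k) / P.card| ≤ κ) (hκ0 : 0 ≤ κ)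
    (hd : 0 < d) (ha0 : ∀ k, 0 ≤ a' k) (ha01 : a' 0 = 1) (ha1 : a 0 = 1)
    (haM : ∀ k < d, a' k ≤ M) (hb0 : ∀ k, 0 ≤ b' k) (hbM : ∀ k < d, b' k ≤ M) (hb00 : b' 0 ≤ b 0)
    (ha : ∀ k < d, a (k + 1) ≤ a' (k + 1) + g * a' k)
    (hb : ∀ k < d, b' (k + 1) + g * b' k ≤ b (k + 1))
    (hρ0 : 0 ≤ ρ)
    (hρ : ∑ k ∈ Finset.range d, b k * X k = ρ * ∑ k ∈ Finset.range d, a k * X k) :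
    (∑ e ∈ P, (∑ k ∈ Finset.range d, b' k * (X k - δ e k)) /
      (∑ k ∈ Finset.range d, a' k * (X k - δ e k))) / P.card ≤
    ρ + d * (M * (1 + ρ)) * (κ / X 0 + 4 * d * M / ((X 0 - 2) * X 0)) := by
  have hM : 1 ≤ M := ha01 ▸ haM 0 hd
  have hX0' : 0 < X 0 := by linarith
  have hc : (0 : ℝ) < P.card := by exact_mod_cast hP.card_pos
  set S : ℝ := d * (M * (1 + ρ)) with hS
  have hS0 : 0 ≤ S := by positivity
  -- Weights of the numerator minus `ρ` times the denominator: the new quotient exceeds `ρ` exactly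
  -- when this combination is positive.
  set w' : ℕ → ℝ := fun k => b' k - ρ * a' k with hw'
  have hwabs : ∀ k < d, |w' k| ≤ M * (1 + ρ) := by
    intro k hk
    have h1 := ha0 k; have h2 := haM k hk; have h3 := hb0 k; have h4 := hbM k hk
    have h5 := mul_le_mul_of_nonneg_left h2 hρ0
    have h6 := mul_nonneg hρ0 h1
    rw [abs_le]; constructor <;> simp only [hw'] <;> nlinarith
  -- replace the weights beyond `d` so that the drift inequality holds for all indices
  have hflow : ∑ k ∈ Finset.range d, w' k * (X k + g * X (k + 1)) ≤ 0 := by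
    have h1 := sum_shift_le (d := d) (X := X) (g := g)
      (w' := fun k => if k < d then w' k else 0)
      (w := fun k => if k < d then b k - ρ * a k else if k = d then
        g * w' (k - 1) else 0) hX hXd
      (by simp only [hd, if_true, hw', ha01, ha1]; linarith)
      (by
        intro k
        by_cases h1 : k + 1 < d
        · have h2 : k < d := by omega
          simp only [h1, h2, if_true, hw']
          nlinarith [ha k h2, hb k h2, mul_le_mul_of_nonneg_left (ha k h2) hρ0]
        · by_cases h2 : k < d
          · have h3 : k + 1 = d := by omega
            have h4 : d - 1 = k := by omega
            simp [h3, h2, h4]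
          · have h3 : k + 1 ≠ d := by omega
            simp [h1, h2, h3])
    have e1 : ∑ k ∈ Finset.range d, (if k < d then w' k else 0) * (X k + g * X (k + 1)) =
        ∑ k ∈ Finset.range d, w' k * (X k + g * X (k + 1)) :=
      Finset.sum_congr rfl fun k hk => by rw [if_pos (Finset.mem_range.1 hk)]
    have e2 : ∑ k ∈ Finset.range d, (if k < d then b k - ρ * a k else if k = d then
        g * w' (k - 1) else 0) * X k = ∑ k ∈ Finset.range d, (b k * X k - ρ * (a k * X k)) :=
      Finset.sum_congr rfl fun k hk => by rw [if_pos (Finset.mem_range.1 hk)]; ring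
    rw [e1, e2, Finset.sum_sub_distrib, ← Finset.mul_sum, hρ, sub_self] at h1
    exact h1
  -- The denominator with new weights but old excesses. It does not depend on `e`, so averaging `y e
  -- / A₁` stays linear; exchanging it for the true denominator costs only second order.
  set A₁ : ℝ := ∑ k ∈ Finset.range d, a' k * X k with hA₁
  have hA₁X : X 0 ≤ A₁ := by
    have := Finset.single_le_sum (f := fun k => a' k * X k)
      (fun k _ => mul_nonneg (ha0 k) (hX k)) (Finset.mem_range.2 hd)
    simpa [ha01] using this
  -- The fluctuation of the step around its idealised drift: bounded for each `e`, and of order `κ`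
  -- in mean.
  set y : ι → ℝ := fun e => ∑ k ∈ Finset.range d, w' k * (h * (X k - X (k + 1)) - δ e k) with hy
  have hyabs : ∀ e ∈ P, |y e| ≤ 2 * S := by
    intro e he
    refine (Finset.abs_sum_le_sum_abs _ _).trans ?_
    have : ∀ k ∈ Finset.range d, |w' k * (h * (X k - X (k + 1)) - δ e k)| ≤
        M * (1 + ρ) * 2 := by
      intro k hk
      rw [abs_mul]
      refine mul_le_mul (hwabs k (Finset.mem_range.1 hk)) ?_ (abs_nonneg _) (by positivity)
      have h1 := hδ0 e he k; have h2 := hδ2 e he k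
      have h3 := mul_nonneg hh0 (hN0 k)
      rw [abs_le]; constructor <;> linarith [hN k]
    refine (Finset.sum_le_sum this).trans (le_of_eq ?_)
    rw [Finset.sum_const, Finset.card_range, nsmul_eq_mul, hS]; ring
  have hterm : ∀ e ∈ P, (∑ k ∈ Finset.range d, b' k * (X k - δ e k)) /
      (∑ k ∈ Finset.range d, a' k * (X k - δ e k)) ≤
      ρ + (y e / A₁ + 2 * S * (2 * (d * M)) / ((X 0 - 2) * X 0)) := by
    intro e he
    set A' : ℝ := ∑ k ∈ Finset.range d, a' k * (X k - δ e k) with hA'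
    have hA'X : X 0 - 2 ≤ A' := by
      have := Finset.single_le_sum (f := fun k => a' k * (X k - δ e k))
        (fun k _ => mul_nonneg (ha0 k) (sub_nonneg.2 (hδX e he k))) (Finset.mem_range.2 hd)
      simp only [ha01, one_mul] at this
      linarith [hδ2 e he 0]
    have hA'0 : 0 < A' := by linarith
    have hA₁0 : 0 < A₁ := by linarith
    have hdiff : A₁ - A' = ∑ k ∈ Finset.range d, a' k * δ e k := by
      rw [hA₁, hA', ← Finset.sum_sub_distrib]
      exact Finset.sum_congr rfl fun k _ => by ring
    have hdiff0 : 0 ≤ A₁ - A' := by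
      rw [hdiff]; exact Finset.sum_nonneg fun k _ => mul_nonneg (ha0 k) (hδ0 e he k)
    have hdiff2 : A₁ - A' ≤ 2 * (d * M) := by
      rw [hdiff]
      have : ∀ k ∈ Finset.range d, a' k * δ e k ≤ M * 2 := fun k hk =>
        mul_le_mul (haM k (Finset.mem_range.1 hk)) (hδ2 e he k) (hδ0 e he k) (by linarith)
      refine (Finset.sum_le_sum this).trans (le_of_eq ?_)
      rw [Finset.sum_const, Finset.card_range, nsmul_eq_mul]; ring
    have hnum : ∑ k ∈ Finset.range d, b' k * (X k - δ e k) ≤ ρ * A' + y e := by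
      have e1 : ∑ k ∈ Finset.range d, b' k * (X k - δ e k) - ρ * A' =
          (1 - h) * ∑ k ∈ Finset.range d, w' k * (X k + g * X (k + 1)) + y e := by
        rw [hA', hy, Finset.mul_sum, Finset.mul_sum, ← Finset.sum_sub_distrib,
          ← Finset.sum_add_distrib]
        refine Finset.sum_congr rfl fun k _ => ?_
        simp only [hw']
        linear_combination -(b' k - ρ * a' k) * X (k + 1) * hg
      have := mul_nonpos_of_nonneg_of_nonpos (by linarith : 0 ≤ 1 - h) hflow
      linarith
    have h1 : (∑ k ∈ Finset.range d, b' k * (X k - δ e k)) / A' ≤ ρ + y e / A' := by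
      rw [div_le_iff₀ hA'0, add_mul, div_mul_cancel₀ _ hA'0.ne']
      exact hnum
    have h2 : y e / A' - y e / A₁ = y e * (A₁ - A') / (A' * A₁) := by field_simp
    have h3 : y e * (A₁ - A') / (A' * A₁) ≤ 2 * S * (2 * (d * M)) / ((X 0 - 2) * X 0) := by
      refine div_le_div₀ (by positivity) ?_ (mul_pos (by linarith) hX0')
        (mul_le_mul hA'X hA₁X hX0'.le hA'0.le)
      exact mul_le_mul ((le_abs_self _).trans (hyabs e he)) hdiff2 hdiff0 (by positivity)
    linarith
  have hysum : (∑ e ∈ P, y e) / P.card ≤ S * κ := by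
    have e1 : (∑ e ∈ P, y e) / P.card = ∑ k ∈ Finset.range d,
        w' k * (h * (X k - X (k + 1)) - (∑ e ∈ P, δ e k) / P.card) := by
      simp only [hy]
      rw [Finset.sum_comm, Finset.sum_div]
      refine Finset.sum_congr rfl fun k _ => ?_
      rw [← Finset.mul_sum, Finset.sum_sub_distrib, Finset.sum_const, nsmul_eq_mul]
      field_simp
    rw [e1]
    have : ∀ k ∈ Finset.range d, w' k * (h * (X k - X (k + 1)) - (∑ e ∈ P, δ e k) / P.card) ≤
        M * (1 + ρ) * κ := by
      intro k hk
      refine (le_abs_self _).trans ?_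
      rw [abs_mul]
      exact mul_le_mul (hwabs k (Finset.mem_range.1 hk)) (hκ k) (abs_nonneg _) (by positivity)
    refine (Finset.sum_le_sum this).trans (le_of_eq ?_)
    rw [Finset.sum_const, Finset.card_range, nsmul_eq_mul, hS]; ring
  have hfin := div_le_div_of_nonneg_right (Finset.sum_le_sum hterm) hc.le
  refine hfin.trans ?_
  rw [Finset.sum_add_distrib, Finset.sum_add_distrib, ← Finset.sum_div, Finset.sum_const,
    Finset.sum_const, nsmul_eq_mul, nsmul_eq_mul, add_div, add_div, mul_div_cancel_left₀ _ hc.ne',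
    mul_div_cancel_left₀ _ hc.ne', div_right_comm]
  have h1 : (∑ e ∈ P, y e) / P.card / A₁ ≤ S * κ / X 0 :=
    div_le_div₀ (by positivity) hysum hX0' hA₁X
  have h2 : S * (κ / X 0 + 4 * d * M / ((X 0 - 2) * X 0)) =
      S * κ / X 0 + 2 * S * (2 * (d * M)) / ((X 0 - 2) * X 0) := by ring
  rw [h2]
  linarith

/-! ### Drift of the excesses, the potentials and the adjacent pairs -/

/-- The threshold `8 * d ^ 2` keeps `numUnsat - d` comparable with `numUnsat`; in particular the
process is not stuck. -/
theorem numUnsat_ge {d : ℕ} (hd : 2 ≤ d) {G : SimpleGraph (Fin n)}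
    (hD : 8 * (d : ℝ) ^ 2 ≤ excess d G 0) : 8 * (d : ℝ) ≤ numUnsat d G := by
  have h1 := excess_zero_le d G
  have hd' : (2 : ℝ) ≤ d := by exact_mod_cast hd
  have h2 : (d : ℝ) * (8 * d) ≤ d * numUnsat d G := by linarith [sq (d : ℝ)]
  exact le_of_mul_le_mul_left h2 (by linarith)

theorem card_available_pos {d : ℕ} (hd : 2 ≤ d) {G : SimpleGraph (Fin n)}
    (hD : 8 * (d : ℝ) ^ 2 ≤ excess d G 0) : (0 : ℝ) < (available d G).card := by
  have h1 := numUnsat_ge hd hD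
  have h2 := le_two_mul_card_available d G
  have hd' : (2 : ℝ) ≤ d := by exact_mod_cast hd
  have : 0 < (numUnsat d G : ℝ) * (numUnsat d G - d) := mul_pos (by linarith) (by linarith)
  linarith

theorem le_mean_hit {d : ℕ} (hd : 2 ≤ d) {G : SimpleGraph (Fin n)}
    (hD : 8 * (d : ℝ) ^ 2 ≤ excess d G 0) (k : ℕ) :
    (freeAbove d G k).card * (2 / numUnsat d G * (1 - d / numUnsat d G)) ≤
      (∑ e ∈ available d G, (hit d G k e : ℝ)) / (available d G).card := by
  have hU := numUnsat_ge hd hD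
  have hc := card_available_pos hd hD
  have hd' : (2 : ℝ) ≤ d := by exact_mod_cast hd
  have h1 := le_sum_hit d G k
  have h2 := two_mul_card_available_le d G
  set U : ℝ := ((numUnsat d G : ℕ) : ℝ)
  set c : ℝ := (((available d G).card : ℕ) : ℝ)
  set N : ℝ := (((freeAbove d G k).card : ℕ) : ℝ)
  have hN : 0 ≤ N := Nat.cast_nonneg _
  have hU0 : 0 < U := by linarith
  rw [le_div_iff₀ hc]
  refine le_trans ?_ h1
  rw [mul_assoc]
  refine mul_le_mul_of_nonneg_left ?_ hN
  have h3 : 2 / U * (1 - d / U) * c = (U - d) * (2 * c) / U ^ 2 := by field_simp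
  rw [h3, div_le_iff₀ (by positivity)]
  refine mul_le_mul_of_nonneg_left ?_ (by linarith)
  nlinarith

theorem mean_hit_le {d : ℕ} (hd : 2 ≤ d) {G : SimpleGraph (Fin n)}
    (hD : 8 * (d : ℝ) ^ 2 ≤ excess d G 0) (k : ℕ) :
    (∑ e ∈ available d G, (hit d G k e : ℝ)) / (available d G).card ≤
      (freeAbove d G k).card * (2 / numUnsat d G * (1 + 2 * d / numUnsat d G)) := by
  have hU := numUnsat_ge hd hD
  have hc := card_available_pos hd hD
  have hd' : (2 : ℝ) ≤ d := by exact_mod_cast hd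
  have h1 := sum_hit_le d G k
  have h2 := le_two_mul_card_available d G
  set U : ℝ := ((numUnsat d G : ℕ) : ℝ)
  set c : ℝ := (((available d G).card : ℕ) : ℝ)
  set N : ℝ := (((freeAbove d G k).card : ℕ) : ℝ)
  have hN : 0 ≤ N := Nat.cast_nonneg _
  have hU0 : 0 < U := by linarith
  rw [div_le_iff₀ hc]
  refine h1.trans ?_
  rw [mul_assoc]
  refine mul_le_mul_of_nonneg_left ?_ hN
  have h3 : 2 / U * (1 + 2 * d / U) * c = (U + 2 * d) * (2 * c) / U ^ 2 := by field_simp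
  rw [h3, le_div_iff₀ (by positivity)]
  have h4 := mul_le_mul_of_nonneg_left h2 (by linarith : 0 ≤ U + 2 * d)
  refine le_trans ?_ h4
  have h5 : (U + 2 * d) * (U * (U - d)) - (U - 1) * U ^ 2 = U * (U * (d + 1) - 2 * d ^ 2) := by
    ring
  have : 0 ≤ U * (U * (d + 1) - 2 * d ^ 2) := mul_nonneg hU0.le (by nlinarith)
  linarith

/-- The weighted sum in the numerator of the potential. -/
noncomputable def upperSum (d : ℕ) (y : ℝ) (G : SimpleGraph (Fin n)) : ℝ :=
  ∑ k ∈ Finset.range d, beta k y * excess d G k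

/-- The weighted sum in the denominator of the potential. -/
noncomputable def lowerSum (d : ℕ) (r : ℝ) (G : SimpleGraph (Fin n)) : ℝ :=
  ∑ k ∈ Finset.range d, alpha k r * excess d G k

theorem upperSum_nonneg (d : ℕ) {y : ℝ} (hy : 0 ≤ y) (G : SimpleGraph (Fin n)) :
    0 ≤ upperSum d y G :=
  Finset.sum_nonneg fun k _ => mul_nonneg (beta_nonneg k hy) (excess_nonneg d G k)

theorem upperSum_mono (d : ℕ) {y z : ℝ} (hy : 0 ≤ y) (hyz : y ≤ z) (G : SimpleGraph (Fin n)) :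
    upperSum d y G ≤ upperSum d z G :=
  Finset.sum_le_sum fun k _ => mul_le_mul_of_nonneg_right (beta_mono k hy hyz)
    (excess_nonneg d G k)

theorem excess_one_le_upperSum {d : ℕ} (hd : 2 ≤ d) {y : ℝ} (hy : 0 ≤ y)
    (G : SimpleGraph (Fin n)) : excess d G 1 ≤ upperSum d y G := by
  have := Finset.single_le_sum (f := fun k => beta k y * excess d G k)
    (fun k _ => mul_nonneg (beta_nonneg k hy) (excess_nonneg d G k)) (Finset.mem_range.2 hd)
  simpa [upperSum, beta] using this

theorem excess_zero_le_lowerSum {d : ℕ} (hd : 2 ≤ d) {r : ℝ} (hr : 0 ≤ r)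
    (G : SimpleGraph (Fin n)) : excess d G 0 ≤ lowerSum d r G := by
  have := Finset.single_le_sum (f := fun k => alpha k r * excess d G k)
    (fun k _ => mul_nonneg (alpha_nonneg k hr) (excess_nonneg d G k))
    (Finset.mem_range.2 (show 0 < d by omega))
  simpa [lowerSum, alpha] using this

theorem lowerSum_le (d : ℕ) {r : ℝ} (hr : 0 ≤ r) (hr2 : r ≤ 2) (G : SimpleGraph (Fin n)) :
    lowerSum d r G ≤ d * excess d G 0 := by
  have : ∀ k ∈ Finset.range d, alpha k r * excess d G k ≤ 1 * excess d G 0 := by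
    intro k _
    refine mul_le_mul ?_ (excess_antitone d G (Nat.zero_le k)) (excess_nonneg d G k) zero_le_one
    have h1 : alpha k r ≤ (r / 2) ^ k := div_le_self (by positivity)
      (by exact_mod_cast Nat.one_le_iff_ne_zero.2 k.factorial_ne_zero)
    exact h1.trans (pow_le_one₀ (by positivity) (by linarith))
  refine (Finset.sum_le_sum this).trans (le_of_eq ?_)
  simp

theorem upperSum_le {d : ℕ} {y z : ℝ} (hy : 0 ≤ y) (hyz : y ≤ z) (hz : 1 ≤ z)
    (G : SimpleGraph (Fin n)) : upperSum d y G ≤ d * (z ^ d * excess d G 0) := by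
  have : ∀ k ∈ Finset.range d, beta k y * excess d G k ≤ z ^ d * excess d G 0 := fun k hk =>
    mul_le_mul (beta_le (Finset.mem_range.1 hk).le hy hyz hz)
      (excess_antitone d G (Nat.zero_le k)) (excess_nonneg d G k) (by positivity)
  refine (Finset.sum_le_sum this).trans (le_of_eq ?_)
  simp

/-- The true hitting probabilities differ from `2 / U` by a factor `1 + O(d / U)`; the bound follows
from `D ≤ d * U`. -/
theorem abs_sub_mean_hit_le {d : ℕ} (hd : 2 ≤ d) {G : SimpleGraph (Fin n)}
    (hD : 8 * (d : ℝ) ^ 2 ≤ excess d G 0) (k : ℕ) :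
    |2 / numUnsat d G * (excess d G k - excess d G (k + 1)) -
      (∑ e ∈ available d G, (hit d G k e : ℝ)) / (available d G).card| ≤
    4 * d ^ 2 / excess d G 0 := by
  have hU := numUnsat_ge hd hD
  have hd' : (2 : ℝ) ≤ d := by exact_mod_cast hd
  have h4 := le_mean_hit hd hD k
  have h5 := mean_hit_le hd hD k
  have hUD := excess_zero_le d G
  have hNU : ((freeAbove d G k).card : ℝ) ≤ numUnsat d G := by
    exact_mod_cast card_freeAbove_le d G k
  have hN : excess d G k - excess d G (k + 1) = (freeAbove d G k).card := by
    rw [excess_eq_add_card d G k]; ring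
  rw [hN]
  have h0 : (0 : ℝ) ≤ (freeAbove d G k).card := Nat.cast_nonneg _
  generalize (∑ e ∈ available d G, (hit d G k e : ℝ)) / (available d G).card = m at *
  generalize ((freeAbove d G k).card : ℝ) = N at *
  generalize (numUnsat d G : ℝ) = U at *
  generalize excess d G 0 = D at *
  have hU0 : 0 < U := by linarith
  have hD0 : 0 < D := by nlinarith
  have h1 : N * (2 / U * (2 * d / U)) ≤ 4 * d ^ 2 / D := by
    calc N * (2 / U * (2 * d / U))
        ≤ U * (2 / U * (2 * d / U)) := mul_le_mul_of_nonneg_right hNU (by positivity)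
      _ = 4 * d / U := by field_simp; norm_num
      _ ≤ 4 * d ^ 2 / D := by
        rw [div_le_div_iff₀ hU0 hD0]
        nlinarith
  have h2 : 0 ≤ N * (2 / U * (d / U)) := by positivity
  have h3 : N * (2 / U * (2 * d / U)) = 2 * (N * (2 / U * (d / U))) := by ring
  have h6 : N * (2 / U * (1 - d / U)) = 2 / U * N - N * (2 / U * (d / U)) := by ring
  have h7 : N * (2 / U * (1 + 2 * d / U)) = 2 / U * N + 2 * (N * (2 / U * (d / U))) := by ring
  rw [abs_le]
  constructor <;> linarith

theorem ratio_error_le {d M D ρ : ℝ} (hd : 2 ≤ d) (hM : 1 ≤ M) (hD : 2 < D)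
    (hρ : ρ ≤ d * M) :
    d * (M * (1 + ρ)) * (4 * d ^ 2 / D / D + 4 * d * M / ((D - 2) * D)) ≤
      16 * d ^ 4 * M ^ 3 / (D - 2) ^ 2 := by
  have hD2 : 0 < D - 2 := by linarith
  have hM0 : 0 < M := by linarith
  have h1 : d * (M * (1 + ρ)) ≤ 2 * d ^ 2 * M ^ 2 := by
    have h : 1 + ρ ≤ 2 * (d * M) := by nlinarith
    calc d * (M * (1 + ρ)) ≤ d * (M * (2 * (d * M))) :=
          mul_le_mul_of_nonneg_left (mul_le_mul_of_nonneg_left h hM0.le) (by linarith)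
      _ = 2 * d ^ 2 * M ^ 2 := by ring
  have h2 : 4 * d ^ 2 / D / D + 4 * d * M / ((D - 2) * D) ≤ 8 * d ^ 2 * M / (D - 2) ^ 2 := by
    have h3 : 4 * d ^ 2 / D / D ≤ 4 * d ^ 2 * M / (D - 2) ^ 2 := by
      rw [div_div]
      exact div_le_div₀ (by positivity) (le_mul_of_one_le_right (by positivity) hM)
        (by positivity) (by nlinarith)
    have h4 : 4 * d * M / ((D - 2) * D) ≤ 4 * d ^ 2 * M / (D - 2) ^ 2 := by
      refine div_le_div₀ (by positivity) (mul_le_mul_of_nonneg_right (by nlinarith) hM0.le)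
        (by positivity) (by nlinarith)
    have h5 : 8 * d ^ 2 * M / (D - 2) ^ 2 =
      4 * d ^ 2 * M / (D - 2) ^ 2 + 4 * d ^ 2 * M / (D - 2) ^ 2 := by ring
    linarith
  refine (mul_le_mul h1 h2 (by positivity) (by positivity)).trans (le_of_eq ?_)
  ring

/-- One step of the early phase. Lowering `r` by the increment of the clock makes the first-order
drift of the quotient nonpositive, so only an error of order `1 / D ^ 2` remains, which is summable
while `D` is large. -/
theorem mean_ratio_le {d : ℕ} (hd : 2 ≤ d) {G : SimpleGraph (Fin n)}
    (hD : 8 * (d : ℝ) ^ 2 ≤ excess d G 0) {H r z : ℝ} (hH : 0 ≤ H) (hr : 2 ≤ r)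
    (hz : H + r ≤ z) :
    (∑ e ∈ available d G,
      upperSum d (H + (r - 2 / (numUnsat d G - 2))) (G ⊔ SimpleGraph.fromEdgeSet {e}) /
        lowerSum d (r - 2 / (numUnsat d G - 2)) (G ⊔ SimpleGraph.fromEdgeSet {e})) /
      (available d G).card ≤
    upperSum d (H + r) G / lowerSum d r G
      + 16 * d ^ 4 * (z ^ d) ^ 3 / (excess d G 0 - 2) ^ 2 := by
  have hU := numUnsat_ge hd hD
  have hc := card_available_pos hd hD
  have hd' : (2 : ℝ) ≤ d := by exact_mod_cast hd
  have hNU : ∀ k, ((freeAbove d G k).card : ℝ) ≤ numUnsat d G := fun k => by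
    exact_mod_cast card_freeAbove_le d G k
  have hN : ∀ k, excess d G k - excess d G (k + 1) = (freeAbove d G k).card := fun k => by
    rw [excess_eq_add_card d G k]; ring
  set U : ℝ := ((numUnsat d G : ℕ) : ℝ)
  set D : ℝ := excess d G 0 with hDdef
  have hU0 : 0 < U := by linarith
  have hD32 : 32 ≤ D := by nlinarith
  -- The solution of `(1 - h) * g = h` for `h = 2 / U`.
  set g : ℝ := 2 / (U - 2) with hg
  have hg0 : 0 < g := div_pos two_pos (by linarith)
  have hgd : 2 * d * g ≤ 1 := by
    rw [hg, mul_div_assoc', div_le_one (by linarith)]; linarith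
  have hg1 : g ≤ 1 := by nlinarith
  set r' : ℝ := r - g with hr'
  have hr'1 : 1 ≤ r' := by linarith
  have hz1 : 1 ≤ z := by linarith
  set M : ℝ := z ^ d with hM
  have hM1 : 1 ≤ M := one_le_pow₀ hz1
  have hA : D ≤ lowerSum d r G := excess_zero_le_lowerSum hd (by linarith) G
  have hB : upperSum d (H + r) G ≤ d * (M * D) := upperSum_le (by linarith) hz hz1 G
  have hB0 : 0 ≤ upperSum d (H + r) G := upperSum_nonneg d (by linarith) G
  set ρ : ℝ := upperSum d (H + r) G / lowerSum d r G with hρ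
  have hρ0 : 0 ≤ ρ := div_nonneg hB0 (by linarith)
  have hρM : ρ ≤ d * M := by
    rw [hρ, div_le_iff₀ (by linarith)]
    calc _ ≤ d * (M * D) := hB
      _ = d * M * D := by ring
      _ ≤ _ := mul_le_mul_of_nonneg_left hA (by positivity)
  have hmain := sum_ratio_le (P := available d G) (Finset.card_pos.1 (by exact_mod_cast hc))
    (d := d) (X := excess d G) (δ := fun e k => (hit d G k e : ℝ))
    (a := fun k => alpha k r) (a' := fun k => alpha k r')
    (b := fun k => beta k (H + r)) (b' := fun k => beta k (H + r'))
    (h := 2 / U) (g := g) (κ := 4 * d ^ 2 / D) (M := M) (ρ := ρ)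
    (excess_nonneg d G) (excess_self d G) (by linarith)
    (fun k => by rw [hN]; positivity)
    (fun k => by
      rw [hN, div_mul_eq_mul_div, div_le_iff₀ hU0]
      linarith [hNU k])
    (by positivity) (by rw [div_le_one hU0]; linarith)
    (by rw [hg]; have : U - 2 ≠ 0 := by linarith
        field_simp)
    (fun e _ k => by positivity)
    (fun e he k => by exact_mod_cast hit_le_two he k)
    (fun e he k => by
      have := excess_nonneg d (G ⊔ SimpleGraph.fromEdgeSet {e}) k
      rw [excess_sup_fromEdgeSet he] at this
      linarith)
    (abs_sub_mean_hit_le hd hD)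
    (by positivity) (by omega)
    (fun k => alpha_nonneg k (by linarith)) (alpha_zero _) (alpha_zero _)
    (fun k hk => alpha_le hk.le (by linarith) (by linarith) hz1)
    (fun k => beta_nonneg k (by linarith))
    (fun k hk => beta_le hk.le (by linarith) (by linarith) hz1)
    le_rfl
    (fun k hk => by
      have := alpha_add_le hk hr'1 hg0.le hgd
      rwa [hr', sub_add_cancel] at this)
    (fun k _ => by
      have := beta_add_le k (y := H + r') (g := g) (by linarith) hg0.le
      have e : H + r' + g = H + r := by rw [hr']; ring
      rwa [e] at this)
    hρ0
    (by
      change upperSum d (H + r) G = ρ * lowerSum d r G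
      rw [hρ, div_mul_cancel₀]; linarith)
  have e1 : ∑ e ∈ available d G, upperSum d (H + r') (G ⊔ SimpleGraph.fromEdgeSet {e}) /
        lowerSum d r' (G ⊔ SimpleGraph.fromEdgeSet {e}) =
      ∑ e ∈ available d G, (∑ k ∈ Finset.range d, beta k (H + r') * (excess d G k - hit d G k e)) /
      (∑ k ∈ Finset.range d, alpha k r' * (excess d G k - hit d G k e)) := by
    refine Finset.sum_congr rfl fun e he => ?_
    simp only [upperSum, lowerSum, excess_sup_fromEdgeSet he]
  rw [e1]
  exact hmain.trans (add_le_add_right (ratio_error_le hd' hM1 (by linarith) hρM) ρ)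

/-- The potential of the late phase. -/
noncomputable def latePotential (d : ℕ) (G : SimpleGraph (Fin n)) : ℝ :=
  (excess d G 0 - d) / excess d G 0 ^ 2 * upperSum d (Real.log (excess d G 0 - 2)) G

/-- The function `2 / x * (1 - d / x)` decreases for `x ≥ 2 * d`. This replaces the random
`numUnsat` by the deterministic number of free places. -/
theorem le_rate {d : ℕ} (hd : 2 ≤ d) {G : SimpleGraph (Fin n)}
    (hD : 8 * (d : ℝ) ^ 2 ≤ excess d G 0) :
    2 / excess d G 0 * (1 - d / excess d G 0) ≤ 2 / numUnsat d G * (1 - d / numUnsat d G) := by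
  have hU := numUnsat_ge hd hD
  have hUD := numUnsat_le_excess d G
  have hd' : (2 : ℝ) ≤ d := by exact_mod_cast hd
  set U : ℝ := ((numUnsat d G : ℕ) : ℝ)
  set D : ℝ := excess d G 0
  have hU0 : 0 < U := by linarith
  have hD0 : 0 < D := by linarith
  have h1 : 2 / D * (1 - d / D) = 2 * (D - d) / D ^ 2 := by field_simp
  have h2 : 2 / U * (1 - d / U) = 2 * (U - d) / U ^ 2 := by field_simp
  rw [h1, h2, div_le_div_iff₀ (by positivity) (by positivity)]
  have h3 : 0 ≤ (D - U) * (U * D - d * D - d * U) := by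
    refine mul_nonneg (by linarith) ?_
    nlinarith
  nlinarith

/-- No error term arises: `q` is a lower bound for the hitting probability. The falling logarithm
pays for the inflow from `X (k + 1)`, and the change of the factor `(D - d) / D ^ 2` is offset by
the decay `1 - q`. -/
theorem mean_latePotential_le {d : ℕ} (hd : 2 ≤ d) {G : SimpleGraph (Fin n)}
    (hD : 8 * (d : ℝ) ^ 2 ≤ excess d G 0) :
    (∑ e ∈ available d G, latePotential d (G ⊔ SimpleGraph.fromEdgeSet {e})) /
      (available d G).card ≤ latePotential d G := by
  have hc := card_available_pos hd hD
  have hd' : (2 : ℝ) ≤ d := by exact_mod_cast hd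
  have hlo := le_mean_hit hd hD
  have hrate := le_rate hd hD
  have hN : ∀ k, excess d G k - excess d G (k + 1) = (freeAbove d G k).card := fun k => by
    rw [excess_eq_add_card d G k]; ring
  have hD0 : ∀ e ∈ available d G,
      excess d (G ⊔ SimpleGraph.fromEdgeSet {e}) 0 = excess d G 0 - 2 := fun e he => by
    rw [excess_sup_fromEdgeSet he, hit_zero he]; norm_num
  set D : ℝ := excess d G 0 with hDdef
  have hD32 : 32 ≤ D := by nlinarith
  set y : ℝ := Real.log (D - 2 - 2) with hy
  have hy0 : 0 ≤ y := Real.log_nonneg (by linarith)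
  set q : ℝ := 2 / D * (1 - d / D) with hq
  have hqe : q = 2 * (D - d) / D ^ 2 := by rw [hq]; field_simp
  have hdD : (d : ℝ) ≤ D := by nlinarith
  have hq0 : 0 ≤ q := by rw [hqe]; exact div_nonneg (by linarith) (by positivity)
  have hqD : q ≤ 2 / D := by
    rw [hqe, div_le_div_iff₀ (by positivity) (by linarith)]
    nlinarith
  have hq1 : q < 1 := lt_of_le_of_lt hqD (by rw [div_lt_one (by linarith)]; linarith)
  set g : ℝ := q / (1 - q) with hg
  have hg0 : 0 ≤ g := div_nonneg hq0 (by linarith)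
  have hgD : g ≤ 2 / (D - 2) := by
    rw [hg, div_le_div_iff₀ (by linarith) (by linarith)]
    rw [le_div_iff₀ (by linarith)] at hqD
    nlinarith
  -- The logarithm is the remaining time: one edge lowers it by at least `2 / (D - 2)`, by `1 - 1 /
  -- x ≤ log x`.
  have hlog : y + g ≤ Real.log (D - 2) := by
    have h1 := Real.one_sub_inv_le_log_of_pos (x := (D - 2) / (D - 2 - 2))
      (div_pos (by linarith) (by linarith))
    rw [Real.log_div (by linarith) (by linarith), inv_div] at h1
    have h2 : 1 - (D - 2 - 2) / (D - 2) = 2 / (D - 2) := by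
      have : D - 2 ≠ 0 := by linarith
      field_simp; ring
    linarith
  have e1 : ∑ e ∈ available d G, latePotential d (G ⊔ SimpleGraph.fromEdgeSet {e}) =
      (D - 2 - d) / (D - 2) ^ 2 * ∑ k ∈ Finset.range d, beta k y *
        ((available d G).card * excess d G k - ∑ e ∈ available d G, (hit d G k e : ℝ)) := by
    have : ∀ e ∈ available d G, latePotential d (G ⊔ SimpleGraph.fromEdgeSet {e}) =
        (D - 2 - d) / (D - 2) ^ 2 * ∑ k ∈ Finset.range d, beta k y *
          (excess d G k - hit d G k e) := by
      intro e he
      simp only [latePotential, upperSum, hD0 e he]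
      congr 1
      exact Finset.sum_congr rfl fun k _ => by rw [excess_sup_fromEdgeSet he]
    rw [Finset.sum_congr rfl this, ← Finset.mul_sum, Finset.sum_comm]
    congr 1
    refine Finset.sum_congr rfl fun k _ => ?_
    rw [← Finset.mul_sum, Finset.sum_sub_distrib, Finset.sum_const, nsmul_eq_mul]
  rw [e1, mul_div_assoc, Finset.sum_div]
  have h2 : ∑ k ∈ Finset.range d, beta k y *
        ((available d G).card * excess d G k - ∑ e ∈ available d G, (hit d G k e : ℝ)) /
          (available d G).card ≤
      (1 - q) * ∑ k ∈ Finset.range d, beta k y * (excess d G k + g * excess d G (k + 1)) := by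
    rw [Finset.mul_sum]
    refine Finset.sum_le_sum fun k _ => ?_
    have h3 : beta k y *
        ((available d G).card * excess d G k - ∑ e ∈ available d G, (hit d G k e : ℝ)) /
          (available d G).card = beta k y * (excess d G k -
            (∑ e ∈ available d G, (hit d G k e : ℝ)) / (available d G).card) := by
      field_simp
    have h4 : (1 - q) * (beta k y * (excess d G k + g * excess d G (k + 1))) =
        beta k y * (excess d G k - (excess d G k - excess d G (k + 1)) * q) := by
      have : (1 - q) * g = q := by rw [hg]; field_simp [(by linarith : 1 - q ≠ 0)]
      linear_combination beta k y * excess d G (k + 1) * this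
    rw [h3, h4, hN]
    refine mul_le_mul_of_nonneg_left (sub_le_sub_left ?_ _) (beta_nonneg k hy0)
    exact (mul_le_mul_of_nonneg_left hrate (Nat.cast_nonneg _)).trans (hlo k)
  have h5 : ∑ k ∈ Finset.range d, beta k y * (excess d G k + g * excess d G (k + 1)) ≤
      upperSum d (y + g) G :=
    sum_shift_le (excess_nonneg d G) (excess_self d G) le_rfl
      (fun k => beta_add_le k hy0 hg0)
  have h6 := upperSum_mono d (by linarith) hlog G
  have h7 := upperSum_nonneg d (y := Real.log (D - 2)) (by linarith) G
  have hcoef0 : 0 ≤ (D - 2 - d) / (D - 2) ^ 2 := div_nonneg (by nlinarith) (by positivity)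
  have hcoef : (D - 2 - d) / (D - 2) ^ 2 * (1 - q) ≤ (D - d) / D ^ 2 := by
    have h8 : 1 - q = (D ^ 2 - 2 * D + 2 * d) / D ^ 2 := by rw [hqe]; field_simp; ring
    have hD2 : 0 < D - 2 := by linarith
    rw [h8, div_mul_div_comm, div_le_div_iff₀ (by positivity) (by positivity)]
    have h9 : (D - 2 - d) * (D ^ 2 - 2 * D + 2 * d) ≤ (D - d) * (D - 2) ^ 2 := by nlinarith
    nlinarith [mul_le_mul_of_nonneg_right h9 (by positivity : 0 ≤ D ^ 2)]
  calc _ ≤ (D - 2 - d) / (D - 2) ^ 2 * ((1 - q) * upperSum d (Real.log (D - 2)) G) := by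
        refine mul_le_mul_of_nonneg_left (h2.trans ?_) hcoef0
        exact mul_le_mul_of_nonneg_left (h5.trans h6) (by linarith)
    _ = (D - 2 - d) / (D - 2) ^ 2 * (1 - q) * upperSum d (Real.log (D - 2)) G := by ring
    _ ≤ _ := mul_le_mul_of_nonneg_right hcoef h7

/-- Each end of a tight pair is hit with probability about `2 / D`. The total `4 / D` is relaxed to
`3 / D`, which still beats the rate `2 / D` at which `D` itself decreases. -/
theorem mean_unsatPairs_le {d : ℕ} (hd : 2 ≤ d) {G : SimpleGraph (Fin n)}
    (hD : 8 * (d : ℝ) ^ 2 ≤ excess d G 0) :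
    (∑ e ∈ available d G, ((unsatPairs d (G ⊔ SimpleGraph.fromEdgeSet {e})).card : ℝ)) /
      (available d G).card ≤
    (1 - 3 / excess d G 0) * (unsatPairs d G).card
      + 20 * d ^ 2 / excess d G 0 * excess d G 1 := by
  have hU := numUnsat_ge hd hD
  have hc := card_available_pos hd hD
  have hd' : (2 : ℝ) ≤ d := by exact_mod_cast hd
  have hrate := le_rate hd hD
  have hUD := excess_zero_le d G
  have hsum := sum_card_unsatPairs_le d G
  have htight : ((unsatPairs d G).card : ℝ) ≤
      (tightPairs d G).card + 2 * (d * (freeAbove d G 1).card) := by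
    exact_mod_cast card_unsatPairs_le_tightPairs d G
  have hN1 := card_freeAbove_le_excess d G 1
  have hc1 := two_mul_card_available_le d G
  have hc2 := le_two_mul_card_available d G
  set U : ℝ := ((numUnsat d G : ℕ) : ℝ)
  set D : ℝ := excess d G 0
  set c : ℝ := (((available d G).card : ℕ) : ℝ)
  set W : ℝ := (((unsatPairs d G).card : ℕ) : ℝ)
  set T : ℝ := (((tightPairs d G).card : ℕ) : ℝ)
  set N : ℝ := (((freeAbove d G 1).card : ℕ) : ℝ)
  have hN0 : 0 ≤ N := Nat.cast_nonneg _
  have hW0 : 0 ≤ W := Nat.cast_nonneg _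
  have hU0 : 0 < U := by linarith
  have hD0 : 0 < D := by nlinarith
  have hD32 : 8 * (d : ℝ) ^ 2 ≤ D := hD
  -- A lower bound for the probability that a given unsaturated vertex is hit.
  set p : ℝ := (U - d) / c with hp
  have hp0 : 0 ≤ p := div_nonneg (by linarith) hc.le
  have hp1 : 3 / (2 * D) ≤ p := by
    have h1 : 3 / (2 * D) ≤ 2 / D * (1 - d / D) := by
      have : 2 / D * (1 - d / D) = 2 * (D - d) / D ^ 2 := by field_simp
      rw [this, div_le_div_iff₀ (by positivity) (by positivity)]
      have : 4 * (d : ℝ) ≤ D := by nlinarith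
      nlinarith
    refine h1.trans (hrate.trans ?_)
    have h3 : 2 / U * (1 - d / U) = 2 * (U - d) / U ^ 2 := by field_simp
    rw [hp, h3, div_le_div_iff₀ (by positivity) hc]
    have : 2 * c ≤ U ^ 2 := by nlinarith
    nlinarith [mul_le_mul_of_nonneg_left this (by linarith : 0 ≤ U - d)]
  have hp2 : (U - 1) / c ≤ 4 * d / D := by
    rw [div_le_div_iff₀ hc hD0]
    have h1 : U * U ≤ 4 * c := by nlinarith
    have h2 : (U - 1) * D ≤ U * (d * U) :=
      mul_le_mul (by linarith) hUD hD0.le hU0.le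
    nlinarith [mul_le_mul_of_nonneg_left h1 (by linarith : (0 : ℝ) ≤ d)]
  have hp3 : p ≤ 4 * d / D :=
    le_trans (div_le_div_of_nonneg_right (by linarith) hc.le) hp2
  have h1 : (∑ e ∈ available d G, ((unsatPairs d (G ⊔ SimpleGraph.fromEdgeSet {e})).card : ℝ)) / c
      ≤ W - 2 * T * p + N * ((U - 1) / c) := by
    rw [div_le_iff₀ hc]
    refine hsum.trans (le_of_eq ?_)
    rw [hp]; field_simp
  refine h1.trans ?_
  have h2 : (W - 2 * (d * N)) * p ≤ T * p := mul_le_mul_of_nonneg_right (by linarith) hp0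
  have h3 : W * (3 / (2 * D)) ≤ W * p := mul_le_mul_of_nonneg_left hp1 hW0
  have h4 : N * ((U - 1) / c) ≤ excess d G 1 * (4 * d / D) :=
    mul_le_mul hN1 hp2 (div_nonneg (by linarith) hc.le) (excess_nonneg d G 1)
  have h5 : N * p ≤ excess d G 1 * (4 * d / D) :=
    mul_le_mul hN1 hp3 hp0 (excess_nonneg d G 1)
  have h6 : 4 * d * (N * p) ≤ 4 * d * (excess d G 1 * (4 * d / D)) :=
    mul_le_mul_of_nonneg_left h5 (by linarith)
  have h7 : excess d G 1 * (4 * d / D) ≤ excess d G 1 * (4 * d ^ 2 / D) :=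
    mul_le_mul_of_nonneg_left (div_le_div_of_nonneg_right (by nlinarith) hD0.le)
      (excess_nonneg d G 1)
  have h8 : (1 - 3 / D) * W = W - 2 * (W * (3 / (2 * D))) := by field_simp
  have h9 : 20 * d ^ 2 / D * excess d G 1 =
    4 * d * (excess d G 1 * (4 * d / D)) + excess d G 1 * (4 * d ^ 2 / D) := by ring
  nlinarith

/-! ### Means along the process and reachable states -/

/-- The mean of `f` after one step of the process from `l`. -/
noncomputable def stepMean (d : ℕ) (f : List (Sym2 (Fin n)) → ℝ) (l : List (Sym2 (Fin n))) : ℝ :=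
  if (available d (graphOf l)).Nonempty then
    (∑ e ∈ available d (graphOf l), f (l ++ [e])) / (available d (graphOf l)).card
  else f l

/-- The mean of `f` after `k` steps of the process. -/
noncomputable def runMean (d n : ℕ) : ℕ → (List (Sym2 (Fin n)) → ℝ) → ℝ
  | 0, f => f []
  | k + 1, f => runMean d n k (stepMean d f)

/-- The states which the process can have after `k` steps. -/
def Reachable (d : ℕ) : ℕ → List (Sym2 (Fin n)) → Prop
  | 0, l => l = []
  | k + 1, l => ∃ l₀, Reachable d k l₀ ∧
      ((∃ e ∈ available d (graphOf l₀), l = l₀ ++ [e]) ∨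
        ¬ (available d (graphOf l₀)).Nonempty ∧ l = l₀)

theorem stepMean_nonneg {d : ℕ} {f : List (Sym2 (Fin n)) → ℝ} (hf : ∀ l, 0 ≤ f l)
    (l : List (Sym2 (Fin n))) : 0 ≤ stepMean d f l := by
  unfold stepMean
  split_ifs
  · exact div_nonneg (Finset.sum_nonneg fun e _ => hf _) (Nat.cast_nonneg _)
  · exact hf l

theorem stepMean_le_stepMean {d k : ℕ} {f g : List (Sym2 (Fin n)) → ℝ}
    (hfg : ∀ l, Reachable d (k + 1) l → f l ≤ g l) {l : List (Sym2 (Fin n))}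
    (hl : Reachable d k l) : stepMean d f l ≤ stepMean d g l := by
  unfold stepMean
  split_ifs with h
  · exact div_le_div_of_nonneg_right
      (Finset.sum_le_sum fun e he => hfg _ ⟨l, hl, Or.inl ⟨e, he, rfl⟩⟩) (Nat.cast_nonneg _)
  · exact hfg _ ⟨l, hl, Or.inr ⟨h, rfl⟩⟩

theorem runMean_mono {d k : ℕ} {f g : List (Sym2 (Fin n)) → ℝ}
    (hfg : ∀ l, Reachable d k l → f l ≤ g l) : runMean d n k f ≤ runMean d n k g := by
  induction k generalizing f g with
  | zero => exact hfg [] rfl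
  | succ k ih => exact ih fun l hl => stepMean_le_stepMean hfg hl

theorem stepMean_linear (d : ℕ) (a b : ℝ) (f g : List (Sym2 (Fin n)) → ℝ) :
    stepMean d (fun l => a * f l + b * g l) = fun l => a * stepMean d f l + b * stepMean d g l := by
  funext l
  unfold stepMean
  split_ifs
  · rw [Finset.sum_add_distrib, ← Finset.mul_sum, ← Finset.mul_sum]
    ring
  · rfl

theorem runMean_linear (d k : ℕ) (a b : ℝ) (f g : List (Sym2 (Fin n)) → ℝ) :
    runMean d n k (fun l => a * f l + b * g l) = a * runMean d n k f + b * runMean d n k g := by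
  induction k generalizing f g with
  | zero => rfl
  | succ k ih => simp only [runMean, stepMean_linear, ih]

theorem stepMean_const (d : ℕ) (c : ℝ) :
    stepMean d (fun _ : List (Sym2 (Fin n)) => c) = fun _ => c := by
  funext l
  unfold stepMean
  split_ifs with h
  · have : ((available d (graphOf l)).card : ℝ) ≠ 0 := by exact_mod_cast h.card_pos.ne'
    rw [Finset.sum_const, nsmul_eq_mul, mul_div_cancel_left₀ _ this]
  · rfl

theorem runMean_const (d k : ℕ) (c : ℝ) : runMean d n k (fun _ => c) = c := by
  induction k with
  | zero => rfl
  | succ k ih => rw [runMean, stepMean_const, ih]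

theorem runMean_add_const (d k : ℕ) (f : List (Sym2 (Fin n)) → ℝ) (c : ℝ) :
    runMean d n k (fun l => f l + c) = runMean d n k f + c := by
  have h := runMean_linear d k 1 1 f (fun _ : List (Sym2 (Fin n)) => c)
  simpa only [one_mul, runMean_const] using h

theorem tsum_bind_mul {α β : Type*} (p : PMF α) (q : α → PMF β) (F : β → ENNReal) :
    ∑' b, (p.bind q) b * F b = ∑' a, p a * ∑' b, q a b * F b := by
  simp only [PMF.bind_apply, ← ENNReal.tsum_mul_right, ← ENNReal.tsum_mul_left]
  rw [ENNReal.tsum_comm]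
  simp only [mul_assoc]

theorem tsum_pure_mul {α : Type*} (a : α) (F : α → ENNReal) :
    ∑' b, (PMF.pure a) b * F b = F a := by
  rw [tsum_eq_single a fun b hb => by simp [hb]]
  simp

theorem tsum_step_mul {d : ℕ} {f : List (Sym2 (Fin n)) → ℝ} (hf : ∀ l, 0 ≤ f l)
    (l : List (Sym2 (Fin n))) :
    ∑' l', step d l l' * ENNReal.ofReal (f l') = ENNReal.ofReal (stepMean d f l) := by
  unfold step stepMean
  split_ifs with h
  · have hc : (0 : ℝ) < (available d (graphOf l)).card := by exact_mod_cast h.card_pos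
    rw [PMF.map, tsum_bind_mul]
    simp only [Function.comp_apply, tsum_pure_mul]
    rw [tsum_eq_sum (s := available d (graphOf l)) fun e he => by
      rw [PMF.uniformOfFinset_apply_of_notMem h he, zero_mul]]
    rw [Finset.sum_congr rfl fun e he => by rw [PMF.uniformOfFinset_apply_of_mem h he],
      ← Finset.mul_sum, div_eq_inv_mul, ENNReal.ofReal_mul (by positivity),
      ENNReal.ofReal_inv_of_pos hc, ENNReal.ofReal_natCast,
      ENNReal.ofReal_sum_of_nonneg fun e _ => hf _]
  · exact tsum_pure_mul _ _

theorem tsum_run_mul {d : ℕ} (k : ℕ) {f : List (Sym2 (Fin n)) → ℝ} (hf : ∀ l, 0 ≤ f l) :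
    ∑' l, run d n k l * ENNReal.ofReal (f l) = ENNReal.ofReal (runMean d n k f) := by
  induction k generalizing f with
  | zero => exact tsum_pure_mul _ _
  | succ k ih =>
    rw [run, tsum_bind_mul, runMean, ← ih (stepMean_nonneg hf)]
    simp only [tsum_step_mul hf]

/-- The bridge from the `PMF` to the real-valued recursion in which all estimates are made. -/
theorem toOuterMeasure_run (d k : ℕ) (S : Set (List (Sym2 (Fin n)))) :
    (run d n k).toOuterMeasure S = ENNReal.ofReal (runMean d n k (S.indicator 1)) := by
  rw [PMF.toOuterMeasure_apply, ← tsum_run_mul k fun l => Set.indicator_nonneg (by simp) l]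
  refine tsum_congr fun l => ?_
  by_cases hl : l ∈ S <;> simp [hl]

theorem degree_graphOf_nil (v : Fin n) :
    (graphOf ([] : List (Sym2 (Fin n)))).degree v = 0 := by
  rw [← SimpleGraph.card_neighborFinset_eq_degree, Finset.card_eq_zero]
  ext x
  rw [SimpleGraph.mem_neighborFinset]
  simp [graphOf]

theorem excess_append {d : ℕ} {l : List (Sym2 (Fin n))} {e : Sym2 (Fin n)}
    (he : e ∈ available d (graphOf l)) :
    excess d (graphOf (l ++ [e])) 0 = excess d (graphOf l) 0 - 2 := by
  rw [graphOf_append, excess_sup_fromEdgeSet he, hit_zero he]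
  norm_num

theorem excess_zero_of_reachable {d k : ℕ} {l : List (Sym2 (Fin n))} (hl : Reachable d k l) :
    excess d (graphOf l) 0 = d * n - 2 * l.length := by
  induction k generalizing l with
  | zero =>
    obtain rfl := hl
    simp [excess, free, degree_graphOf_nil, mul_comm]
  | succ k ih =>
    obtain ⟨l₀, h₀, ⟨e, he, rfl⟩ | ⟨-, rfl⟩⟩ := hl
    · rw [excess_append he, ih h₀]
      simp only [List.length_append, List.length_singleton]
      push_cast; ring
    · exact ih h₀

theorem card_edgeFinset_of_reachable {d k : ℕ} {l : List (Sym2 (Fin n))}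
    (hl : Reachable d k l) : (graphOf l).edgeFinset.card = l.length := by
  have h1 := SimpleGraph.sum_degrees_eq_twice_card_edges (graphOf l)
  have h2 : ∑ v, (graphOf l).degree v = 2 * l.length := by
    clear h1
    induction k generalizing l with
    | zero => obtain rfl := hl; simp [degree_graphOf_nil]
    | succ k ih =>
      obtain ⟨l₀, h₀, ⟨e, he, rfl⟩ | ⟨-, rfl⟩⟩ := hl
      · simp only [degree_eq_of_eq_sup he (graphOf_append l₀ e), Finset.sum_add_distrib, ih h₀,
          List.length_append, List.length_singleton]
        have h3 := hit_zero he
        have h4 : ∑ v, (if v ∈ e then 1 else 0) = hit d (graphOf l₀) 0 e := by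
          rw [hit, freeAbove, Finset.filter_filter, Finset.card_filter]
          refine Finset.sum_congr rfl fun v _ => ?_
          by_cases hv : v ∈ e
          · simp [hv, free_pos_of_mem he hv]
          · simp [hv]
        omega
      · exact ih h₀
  omega

theorem deficit_of_reachable {d k : ℕ} {l : List (Sym2 (Fin n))} (hl : Reachable d k l) :
    deficit d (graphOf l) = d * n / 2 - l.length := by
  rw [deficit, ← card_edgeFinset_of_reachable hl]

theorem reachable_take {d k : ℕ} {l : List (Sym2 (Fin n))} (hl : Reachable d k l) (s : ℕ)
    (hs : s ≤ l.length) : ∃ j, Reachable d j (l.take s) := by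
  induction k generalizing l with
  | zero => obtain rfl := hl; exact ⟨0, by simp [Reachable]⟩
  | succ k ih =>
    rcases hs.lt_or_eq with hs | rfl
    · obtain ⟨l₀, h₀, ⟨e, he, rfl⟩ | ⟨-, rfl⟩⟩ := hl
      · have hs' : s ≤ l₀.length := by simpa [Nat.lt_succ_iff] using hs
        rw [List.take_append_of_le_length hs']
        exact ih h₀ hs'
      · exact ih h₀ hs.le
    · rw [List.take_length]
      exact ⟨_, hl⟩

/-! ### The clock and the potential along the process -/

/-- The total hazard to which an unsaturated vertex was exposed so far. -/
noncomputable def clock (d : ℕ) (l : List (Sym2 (Fin n))) : ℝ :=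
  ∑ i ∈ Finset.range l.length, 2 / ((numUnsat d (graphOf (l.take i)) : ℝ) - 2)

theorem clock_append (d : ℕ) (l : List (Sym2 (Fin n))) (e : Sym2 (Fin n)) :
    clock d (l ++ [e]) = clock d l + 2 / ((numUnsat d (graphOf l) : ℝ) - 2) := by
  rw [clock, List.length_append, List.length_singleton, Finset.sum_range_succ,
    List.take_left, clock]
  congr 1
  refine Finset.sum_congr rfl fun i hi => ?_
  rw [List.take_append_of_le_length (Finset.mem_range.1 hi).le]

/-- Since `U ≤ D`, each step advances the clock by at least `2 / (D - 2)`, and `exp (-2 / (D - 2)) ≤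
1 - 2 / D`. The clock is random, so this serves twice: a small clock forces many free places, and
few free places force the clock past `T`. -/
theorem excess_ge_of_reachable {d : ℕ} (hd : 2 ≤ d) {k : ℕ} {l : List (Sym2 (Fin n))}
    (hl : Reachable d k l) (hD : 8 * (d : ℝ) ^ 2 ≤ excess d (graphOf l) 0) :
    d * n * Real.exp (-clock d l) ≤ excess d (graphOf l) 0 := by
  induction k generalizing l with
  | zero =>
    rw [excess_zero_of_reachable hl]
    obtain rfl := hl
    simp [clock]
  | succ k ih =>
    obtain ⟨l₀, h₀, ⟨e, he, rfl⟩ | ⟨-, rfl⟩⟩ := hl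
    · rw [excess_append he] at hD ⊢
      have hD₀ : 8 * (d : ℝ) ^ 2 ≤ excess d (graphOf l₀) 0 := by linarith
      have h1 := ih h₀ hD₀
      have hU := numUnsat_ge hd hD₀
      have hUD := numUnsat_le_excess d (graphOf l₀)
      have hd' : (2 : ℝ) ≤ d := by exact_mod_cast hd
      rw [clock_append, neg_add, Real.exp_add, ← mul_assoc]
      set D := excess d (graphOf l₀) 0
      set U : ℝ := ((numUnsat d (graphOf l₀) : ℕ) : ℝ)
      have h2 : Real.exp (-(2 / (U - 2))) ≤ 1 - 2 / D := by
        have h3 : Real.exp (-(2 / (U - 2))) ≤ Real.exp (-(2 / (D - 2))) := by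
          rw [Real.exp_le_exp, neg_le_neg_iff]
          exact div_le_div_of_nonneg_left (by norm_num) (by linarith) (by linarith)
        refine h3.trans ?_
        rw [Real.exp_neg, inv_le_comm₀ (Real.exp_pos _)
          (by rw [sub_pos, div_lt_one (by linarith)]; linarith)]
        refine le_trans (le_of_eq ?_) (Real.add_one_le_exp _)
        have h4 : D ≠ 0 := by linarith
        have h5 : D - 2 ≠ 0 := by linarith
        field_simp
        ring
      calc _ ≤ D * (1 - 2 / D) :=
            mul_le_mul h1 h2 (Real.exp_pos _).le (by linarith)
        _ = D - 2 := by
            have h4 : D ≠ 0 := by linarith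
            field_simp
    · exact ih h₀ hD

/-- The potential, which controls the number of free places beyond the first ones. -/
noncomputable def potential (d : ℕ) (H T : ℝ) (l : List (Sym2 (Fin n))) : ℝ :=
  if 2 ≤ T - clock d l then
    d * (upperSum d (H + (T - clock d l)) (graphOf l) / lowerSum d (T - clock d l) (graphOf l))
  else latePotential d (graphOf l)

/-- The change of phase does not raise the potential: for `r ≤ 2` all weights `alpha` are at most 1,
so `lowerSum` is at most `d * D`. This is why `potential` carries the factor `d`, and why `H` must
dominate the logarithm. -/
theorem latePotential_le {d : ℕ} (hd : 2 ≤ d) {G : SimpleGraph (Fin n)}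
    (hD : 3 ≤ excess d G 0) {H r : ℝ} (hr : 0 ≤ r) (hr2 : r ≤ 2)
    (hH : Real.log (excess d G 0 - 2) ≤ H) :
    latePotential d G ≤ d * (upperSum d (H + r) G / lowerSum d r G) := by
  have hlog : 0 ≤ Real.log (excess d G 0 - 2) := Real.log_nonneg (by linarith)
  have hd' : (2 : ℝ) ≤ d := by exact_mod_cast hd
  have h1 := upperSum_mono d hlog (by linarith : Real.log (excess d G 0 - 2) ≤ H + r) G
  have h2 := lowerSum_le d hr hr2 G
  have h3 := excess_zero_le_lowerSum hd hr G
  have h4 := upperSum_nonneg d (by linarith : 0 ≤ H + r) G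
  rw [latePotential]
  set D := excess d G 0
  have hD0 : 0 < D := by linarith
  calc (D - d) / D ^ 2 * upperSum d (Real.log (D - 2)) G
      ≤ 1 / D * upperSum d (H + r) G := by
        refine mul_le_mul ?_ h1 (upperSum_nonneg d hlog G) (by positivity)
        rw [div_le_div_iff₀ (by positivity) hD0]
        nlinarith
    _ = d * (upperSum d (H + r) G / (d * D)) := by field_simp
    _ ≤ _ := by
        refine mul_le_mul_of_nonneg_left ?_ (by linarith)
        exact div_le_div_of_nonneg_left h4 (by linarith) h2

theorem stepMean_potential_le {d : ℕ} (hd : 2 ≤ d) {k : ℕ} {l : List (Sym2 (Fin n))}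
    (hl : Reachable d k l) (hD : 8 * (d : ℝ) ^ 2 ≤ excess d (graphOf l) 0) {H T Q : ℝ}
    (hH : Real.log (d * n) ≤ H) (hH0 : 0 ≤ H) (hT : 1 ≤ T) (hcl : 0 ≤ clock d l)
    (hQ : 1 ≤ Q) (hnQ : Q ≤ n * Real.exp (-T)) :
    stepMean d (potential d H T) l ≤
      potential d H T l + 16 * d ^ 5 * ((H + T) ^ d) ^ 3 / Q ^ 2 := by
  have hc := card_available_pos hd hD
  have hne : (available d (graphOf l)).Nonempty := Finset.card_pos.1 (by exact_mod_cast hc)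
  have hU := numUnsat_ge hd hD
  have hd' : (2 : ℝ) ≤ d := by exact_mod_cast hd
  have hDl := excess_zero_of_reachable hl
  have hg0 : 0 < 2 / ((numUnsat d (graphOf l) : ℝ) - 2) := div_pos two_pos (by linarith)
  have hg1 : 2 / ((numUnsat d (graphOf l) : ℝ) - 2) ≤ 1 := by
    rw [div_le_one (by linarith)]; linarith
  have hD32 : 32 ≤ excess d (graphOf l) 0 := by nlinarith
  have hdD : (d : ℝ) + 2 ≤ excess d (graphOf l) 0 := by nlinarith
  rw [stepMean, if_pos hne]
  by_cases hr : 2 ≤ T - clock d l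
  · have hlow := excess_ge_of_reachable hd hl hD
    have hQD : Q ≤ excess d (graphOf l) 0 - 2 := by
      -- Before the change of phase `exp (T - clock) ≥ 3`, which leaves room for the `- 2` in the
      -- bound on `Q`.
      have h1 : Real.exp (-T) * 3 ≤ Real.exp (-clock d l) := by
        have h2 : Real.exp (-clock d l) = Real.exp (-T) * Real.exp (T - clock d l) := by
          rw [← Real.exp_add]; ring_nf
        rw [h2]
        refine mul_le_mul_of_nonneg_left ?_ (Real.exp_pos _).le
        linarith [Real.add_one_le_exp (T - clock d l)]
      have h3 : (n : ℝ) * (Real.exp (-T) * 3) ≤ n * Real.exp (-clock d l) :=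
        mul_le_mul_of_nonneg_left h1 (Nat.cast_nonneg _)
      have h4 : 2 * (n * Real.exp (-clock d l)) ≤ d * (n * Real.exp (-clock d l)) :=
        mul_le_mul_of_nonneg_right hd' (by positivity)
      linarith
    have hmean := mean_ratio_le hd hD hH0 hr (z := H + T) (by linarith)
    have hterm : ∀ e ∈ available d (graphOf l), potential d H T (l ++ [e]) ≤
        d * (upperSum d (H + (T - clock d l - 2 / (numUnsat d (graphOf l) - 2)))
          (graphOf l ⊔ SimpleGraph.fromEdgeSet {e}) /
        lowerSum d (T - clock d l - 2 / (numUnsat d (graphOf l) - 2))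
          (graphOf l ⊔ SimpleGraph.fromEdgeSet {e})) := by
      intro e he
      rw [potential, clock_append, ← sub_sub, ← graphOf_append]
      split_ifs with h
      · exact le_rfl
      · have h5 := excess_append he
        refine latePotential_le hd (by linarith) (by linarith)
          (le_of_not_ge h) (le_trans ?_ hH)
        refine Real.log_le_log (by linarith) ?_
        rw [h5, hDl]
        have : (0 : ℝ) ≤ l.length := Nat.cast_nonneg _
        linarith
    have h6 := div_le_div_of_nonneg_right (Finset.sum_le_sum hterm) hc.le
    refine h6.trans ?_
    rw [← Finset.mul_sum, mul_div_assoc, potential, if_pos hr]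
    refine (mul_le_mul_of_nonneg_left hmean (by linarith : (0 : ℝ) ≤ d)).trans ?_
    rw [mul_add]
    refine add_le_add_right ?_ _
    have h7 : (d : ℝ) * (16 * d ^ 4 * ((H + T) ^ d) ^ 3 / (excess d (graphOf l) 0 - 2) ^ 2) =
      16 * d ^ 5 * ((H + T) ^ d) ^ 3 / (excess d (graphOf l) 0 - 2) ^ 2 := by ring
    rw [h7]
    have : 0 ≤ H + T := by linarith
    exact div_le_div_of_nonneg_left (by positivity) (by positivity)
      (pow_le_pow_left₀ (by linarith) hQD 2)
  · have hterm : ∀ e ∈ available d (graphOf l), potential d H T (l ++ [e]) =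
        latePotential d (graphOf l ⊔ SimpleGraph.fromEdgeSet {e}) := by
      intro e _
      rw [potential, clock_append, ← graphOf_append, if_neg]
      linarith
    rw [Finset.sum_congr rfl hterm, potential, if_neg hr]
    have h8 := mean_latePotential_le hd hD
    have : 0 ≤ H + T := by linarith
    have h9 : 0 ≤ 16 * d ^ 5 * ((H + T) ^ d) ^ 3 / Q ^ 2 := by positivity
    linarith

theorem clock_nonneg_of_reachable {d : ℕ} (hd : 2 ≤ d) {k : ℕ} {l : List (Sym2 (Fin n))}
    (hl : Reachable d k l) (hD : 8 * (d : ℝ) ^ 2 ≤ excess d (graphOf l) 0) : 0 ≤ clock d l := by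
  induction k generalizing l with
  | zero => obtain rfl := hl; simp [clock]
  | succ k ih =>
    obtain ⟨l₀, h₀, ⟨e, he, rfl⟩ | ⟨-, rfl⟩⟩ := hl
    · rw [excess_append he] at hD
      have hD₀ : 8 * (d : ℝ) ^ 2 ≤ excess d (graphOf l₀) 0 := by linarith
      have hU := numUnsat_ge hd hD₀
      have hd' : (2 : ℝ) ≤ d := by exact_mod_cast hd
      rw [clock_append]
      exact add_nonneg (ih h₀ hD₀) (div_nonneg two_pos.le (by linarith))
    · exact ih h₀ hD

/-- The process cannot get stuck this early, so every step adds an edge and the number of free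
places is deterministic. -/
theorem length_of_reachable {d : ℕ} (hd : 2 ≤ d) {k : ℕ} {l : List (Sym2 (Fin n))}
    (hl : Reachable d k l) (hk : 8 * (d : ℝ) ^ 2 ≤ d * n - 2 * k) : l.length = k := by
  induction k generalizing l with
  | zero => obtain rfl := hl; rfl
  | succ k ih =>
    have hk' : 8 * (d : ℝ) ^ 2 ≤ d * n - 2 * k := by push_cast at hk; linarith
    obtain ⟨l₀, h₀, ⟨e, he, rfl⟩ | ⟨h, -⟩⟩ := hl
    · simpa using ih h₀ hk'
    · refine absurd (Finset.card_pos.1 ?_) h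
      have hD : 8 * (d : ℝ) ^ 2 ≤ excess d (graphOf l₀) 0 := by
        rw [excess_zero_of_reachable h₀, ih h₀ hk']; exact hk'
      exact_mod_cast card_available_pos hd hD

theorem excess_of_reachable {d : ℕ} (hd : 2 ≤ d) {k : ℕ} {l : List (Sym2 (Fin n))}
    (hl : Reachable d k l) (hk : 8 * (d : ℝ) ^ 2 ≤ d * n - 2 * k) :
    excess d (graphOf l) 0 = d * n - 2 * k := by
  rw [excess_zero_of_reachable hl, length_of_reachable hd hl hk]

theorem runMean_potential_le {d : ℕ} (hd : 2 ≤ d) {k : ℕ}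
    (hk : 8 * (d : ℝ) ^ 2 ≤ d * n - 2 * k) {H T Q : ℝ}
    (hH : Real.log (d * n) ≤ H) (hH0 : 0 ≤ H) (hT : 1 ≤ T)
    (hQ : 1 ≤ Q) (hnQ : Q ≤ n * Real.exp (-T)) :
    runMean d n k (potential d H T) ≤
      potential (n := n) d H T [] + k * (16 * d ^ 5 * ((H + T) ^ d) ^ 3 / Q ^ 2) := by
  induction k with
  | zero => simp [runMean]
  | succ k ih =>
    have hk' : 8 * (d : ℝ) ^ 2 ≤ d * n - 2 * k := by push_cast at hk; linarith
    rw [runMean]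
    refine (runMean_mono fun l hl => ?_).trans (le_trans (le_of_eq (runMean_add_const d k
      (potential d H T) (16 * d ^ 5 * ((H + T) ^ d) ^ 3 / Q ^ 2))) ?_)
    · have hD : 8 * (d : ℝ) ^ 2 ≤ excess d (graphOf l) 0 := by
        rw [excess_of_reachable hd hl hk']; exact hk'
      exact stepMean_potential_le hd hl hD hH hH0 hT (clock_nonneg_of_reachable hd hl hD) hQ hnQ
    · have := ih hk'
      push_cast
      linarith

/-- Late in the process, few free places lie beyond the first ones. -/
theorem runMean_excess_one_le {d : ℕ} (hd : 2 ≤ d) {k : ℕ}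
    (hk : 8 * (d : ℝ) ^ 2 ≤ d * n - 2 * k) {H T Q : ℝ}
    (hH : Real.log (d * n) ≤ H) (hH0 : 0 ≤ H) (hT : 1 ≤ T)
    (hQ : 1 ≤ Q) (hnQ : Q ≤ n * Real.exp (-T))
    (hlate : d * n - 2 * (k : ℝ) ≤ d * n * Real.exp (-T)) :
    runMean d n k (fun l => excess d (graphOf l) 1) ≤ 2 * (d * n - 2 * k) *
      (potential (n := n) d H T [] + k * (16 * d ^ 5 * ((H + T) ^ d) ^ 3 / Q ^ 2)) := by
  have hd' : (2 : ℝ) ≤ d := by exact_mod_cast hd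
  set D : ℝ := d * n - 2 * k with hDdef
  have hD32 : 32 ≤ D := by nlinarith
  have hdD : 2 * (d : ℝ) ≤ D := by nlinarith
  have h1 := runMean_potential_le hd hk hH hH0 hT hQ hnQ
  refine le_trans ?_ (mul_le_mul_of_nonneg_left h1 (by linarith))
  have h2 := runMean_linear d k (2 * D) 0 (potential d H T) (fun _ : List (Sym2 (Fin n)) => 0)
  simp only [zero_mul, add_zero] at h2
  rw [← h2]
  refine runMean_mono fun l hl => ?_
  have hDl := excess_of_reachable hd hl hk
  have hlow := excess_ge_of_reachable hd hl (by rw [hDl]; exact hk)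
  have hn : (0 : ℝ) < d * n := by
    have : (0 : ℝ) ≤ k := Nat.cast_nonneg _
    linarith
  -- So few free places are left that every reachable state is in the late phase.
  have hcl : T ≤ clock d l := by
    rw [hDl] at hlow
    have := le_of_mul_le_mul_left (hlow.trans hlate) hn
    rw [Real.exp_le_exp] at this
    linarith
  rw [potential, if_neg (by linarith), latePotential, hDl, ← hDdef]
  have hlog : 0 ≤ Real.log (D - 2) := Real.log_nonneg (by linarith)
  have h3 := excess_one_le_upperSum hd hlog (graphOf l)
  have h4 : 1 ≤ 2 * D * ((D - d) / D ^ 2) := by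
    have : 2 * D * ((D - d) / D ^ 2) = 2 * (D - d) / D := by field_simp
    rw [this, le_div_iff₀ (by linarith)]
    linarith
  rw [← mul_assoc]
  have h5 := upperSum_nonneg d hlog (graphOf l)
  nlinarith

/-! ### Decay of the number of adjacent unsaturated pairs -/

theorem stepMean_card_unsatPairs_le {d : ℕ} (hd : 2 ≤ d) {l : List (Sym2 (Fin n))}
    (hD : 8 * (d : ℝ) ^ 2 ≤ excess d (graphOf l) 0) :
    stepMean d (fun l => ((unsatPairs d (graphOf l)).card : ℝ)) l ≤
      (1 - 3 / excess d (graphOf l) 0) * (unsatPairs d (graphOf l)).card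
        + 20 * d ^ 2 / excess d (graphOf l) 0 * excess d (graphOf l) 1 := by
  have hc := card_available_pos hd hD
  have hne : (available d (graphOf l)).Nonempty := Finset.card_pos.1 (by exact_mod_cast hc)
  rw [stepMean, if_pos hne]
  simp only [graphOf_append]
  exact mean_unsatPairs_le hd hD

/-- It makes `D ^ (3 / 2)` a supersolution of the homogeneous recursion with factor `1 - 3 / D`, as
`D` falls by 2. -/
theorem sub_three_mul_sqrt_le {D : ℝ} (hD : 3 ≤ D) :
    (D - 3) * √D ≤ (D - 2) * √(D - 2) := by
  refine Real.le_sqrt_of_sq_le (x := (D - 3) * √D) (y := (D - 2) ^ 2 * (D - 2)) ?_ |>.trans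
    (le_of_eq ?_)
  · rw [mul_pow, Real.sq_sqrt (by linarith)]
    nlinarith
  · rw [Real.sqrt_mul (by positivity), Real.sqrt_sq (by linarith)]

/-- Late in the process, few unsaturated vertices are adjacent. -/
theorem runMean_card_unsatPairs_le {d : ℕ} (hd : 2 ≤ d) {k₁ k : ℕ} (hk₁ : k₁ ≤ k) {κ : ℝ}
    (hk : 8 * (d : ℝ) ^ 2 ≤ d * n - 2 * k)
    (hexc : ∀ j, k₁ ≤ j → j ≤ k →
      runMean d n j (fun l => excess d (graphOf l) 1) ≤ 2 * (d * n - 2 * j) * κ) :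
    runMean d n k (fun l => ((unsatPairs d (graphOf l)).card : ℝ)) ≤
      40 * d ^ 2 * κ * (d * n - 2 * k)
        + d / √(d * n - 2 * k₁) * ((d * n - 2 * k) * √(d * n - 2 * k)) := by
  have hd' : (2 : ℝ) ≤ d := by exact_mod_cast hd
  induction k, hk₁ using Nat.le_induction with
  | base =>
    set D : ℝ := d * n - 2 * k₁ with hDdef
    have hD32 : 32 ≤ D := by nlinarith
    have hs : 0 < √D := Real.sqrt_pos.2 (by linarith)
    have hκ : 0 ≤ κ := by
      have h0 : 0 ≤ runMean d n k₁ (fun l => excess d (graphOf l) 1) := by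
        have := runMean_mono (d := d) (n := n) (k := k₁) (f := fun _ => 0)
          (g := fun l => excess d (graphOf l) 1) fun l _ => excess_nonneg d _ 1
        rwa [runMean_const] at this
      have h1 := h0.trans (hexc k₁ le_rfl le_rfl)
      exact nonneg_of_mul_nonneg_right h1 (by linarith)
    have h1 : d / √D * (D * √D) = d * D := by field_simp
    rw [h1]
    have h2 : runMean d n k₁ (fun l => ((unsatPairs d (graphOf l)).card : ℝ)) ≤ d * D := by
      rw [← runMean_const (n := n) d k₁ (d * D)]
      refine runMean_mono fun l hl => ?_
      have h3 := card_unsatPairs_le d (graphOf l)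
      have h4 := numUnsat_le_excess d (graphOf l)
      rw [excess_of_reachable hd hl hk] at h4
      calc ((unsatPairs d (graphOf l)).card : ℝ) ≤ d * numUnsat d (graphOf l) := by
            exact_mod_cast h3
        _ ≤ d * D := mul_le_mul_of_nonneg_left h4 (by linarith)
    have : 0 ≤ 40 * d ^ 2 * κ * D := by positivity
    linarith
  | succ k hk₁ ih =>
    have hk' : 8 * (d : ℝ) ^ 2 ≤ d * n - 2 * k := by push_cast at hk; linarith
    have h1 := ih hk' fun j hj hj' => hexc j hj (hj'.trans (Nat.le_succ k))
    have h2 := hexc k hk₁ (Nat.le_succ k)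
    have e1 : (d : ℝ) * n - 2 * ((k + 1 : ℕ) : ℝ) = d * n - 2 * k - 2 := by push_cast; ring
    rw [e1, runMean]
    have h3 : runMean d n k (stepMean d fun l => ((unsatPairs d (graphOf l)).card : ℝ)) ≤
        (1 - 3 / (d * n - 2 * k)) * runMean d n k (fun l => ((unsatPairs d (graphOf l)).card : ℝ))
        + 20 * d ^ 2 / (d * n - 2 * k) * runMean d n k (fun l => excess d (graphOf l) 1) := by
      rw [← runMean_linear]
      refine runMean_mono fun l hl => ?_
      have hDl := excess_of_reachable hd hl hk'
      have := stepMean_card_unsatPairs_le hd (l := l) (by rw [hDl]; exact hk')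
      rwa [hDl] at this
    set D : ℝ := d * n - 2 * k with hDdef
    have hD32 : 32 ≤ D := by nlinarith
    have hβ : 0 ≤ d / √(d * n - 2 * k₁) := by positivity
    set b := d / √(d * n - 2 * k₁)
    have h4 := mul_le_mul_of_nonneg_left h1
      (by rw [sub_nonneg, div_le_one (by linarith)]; linarith : 0 ≤ 1 - 3 / D)
    have h5 := mul_le_mul_of_nonneg_left h2 (by positivity : 0 ≤ 20 * (d : ℝ) ^ 2 / D)
    -- The term `40 * d ^ 2 * κ * D` solves the inhomogeneous recursion exactly: it shrinks in
    -- proportion to `D - 3`, and the source restores `D - 2`.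
    have h6 : 20 * (d : ℝ) ^ 2 / D * (2 * D * κ) = 40 * d ^ 2 * κ := by field_simp; ring
    have h7 : (1 - 3 / D) * (40 * d ^ 2 * κ * D + b * (D * √D)) =
      40 * d ^ 2 * κ * (D - 3) + b * ((D - 3) * √D) := by field_simp
    have h8 := mul_le_mul_of_nonneg_left (sub_three_mul_sqrt_le (by linarith : 3 ≤ D)) hβ
    have h9 : 40 * d ^ 2 * κ * (D - 2) = 40 * d ^ 2 * κ * (D - 3) + 40 * d ^ 2 * κ := by ring
    linarith

/-! ### Absorbing states -/

/-- The states from which no adjacent unsaturated vertices can arise. -/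
def settled (d n t : ℕ) : Set (List (Sym2 (Fin n))) :=
  {l | l ∈ noUnsaturatedEdgeFrom d n t ∧ (∀ v, free d (graphOf l) v ≤ 1) ∧
    ¬ HasUnsaturatedEdge d (graphOf l)}

/-- With at most one free place everywhere, a new edge saturates both its ends, so it cannot join
unsaturated vertices and creates no new unsaturated ones. -/
theorem settled_append {d t : ℕ} {l : List (Sym2 (Fin n))} (hl : l ∈ settled d n t)
    {e : Sym2 (Fin n)} (he : e ∈ available d (graphOf l)) : l ++ [e] ∈ settled d n t := by
  obtain ⟨h1, h2, h3⟩ := hl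
  have hfree : ∀ v, free d (graphOf (l ++ [e])) v =
      free d (graphOf l) v - if v ∈ e then 1 else 0 := fun v => by
    rw [graphOf_append, free_sup_fromEdgeSet he]
  have h4 : ¬ HasUnsaturatedEdge d (graphOf (l ++ [e])) := by
    rintro ⟨u, v, huv, hu, hv⟩
    rw [← free_pos_iff, hfree] at hu hv
    have hue : u ∉ e := fun h => by have := h2 u; rw [if_pos h] at hu; omega
    have hve : v ∉ e := fun h => by have := h2 v; rw [if_pos h] at hv; omega
    rw [if_neg hue, Nat.sub_zero] at hu
    rw [if_neg hve, Nat.sub_zero] at hv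
    rw [graphOf_append, adj_sup_fromEdgeSet] at huv
    rcases huv with huv | ⟨rfl, -⟩
    · exact h3 ⟨u, v, huv, free_pos_iff.1 hu, free_pos_iff.1 hv⟩
    · exact hue (Sym2.mem_mk_left u v)
  refine ⟨fun s hs hdef => ?_, fun v => ?_, h4⟩
  · rcases hs.lt_or_eq with hs | rfl
    · have hs' : s ≤ l.length := by simpa [Nat.lt_succ_iff] using hs
      rw [List.take_append_of_le_length hs'] at hdef ⊢
      exact h1 s hs' hdef
    · rwa [List.take_length]
  · rw [hfree]
    exact (Nat.sub_le _ _).trans (h2 v)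

theorem indicator_settled_le_stepMean {d t : ℕ} (l : List (Sym2 (Fin n))) :
    (settled d n t).indicator (1 : List (Sym2 (Fin n)) → ℝ) l ≤ stepMean d ((settled d n t).indicator 1) l := by
  by_cases hl : l ∈ settled d n t
  · rw [Set.indicator_of_mem hl, stepMean]
    split_ifs with h
    · rw [Finset.sum_congr rfl fun e he => Set.indicator_of_mem (settled_append hl he) _]
      have : ((available d (graphOf l)).card : ℝ) ≠ 0 := by exact_mod_cast h.card_pos.ne'
      simp [this]
    · rw [Set.indicator_of_mem hl]
  · rw [Set.indicator_of_notMem hl]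
    exact stepMean_nonneg (fun l => Set.indicator_nonneg (by simp) l) l

theorem runMean_settled_mono {d t : ℕ} :
    Monotone fun k => runMean d n k ((settled d n t).indicator 1) :=
  monotone_nat_of_le_succ fun _ => runMean_mono fun l _ => indicator_settled_le_stepMean l

/-- Markov's inequality for integer quantities: if the state is not settled, one of the two is at
least 1. -/
theorem one_sub_le_indicator_settled {d t k : ℕ} (hd : 2 ≤ d)
    (hk : 8 * (d : ℝ) ^ 2 ≤ d * n - 2 * k) (ht : k + t ≤ d * n / 2)
    {l : List (Sym2 (Fin n))} (hl : Reachable d k l) :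
    1 - (excess d (graphOf l) 1 + (unsatPairs d (graphOf l)).card) ≤
      (settled d n t).indicator 1 l := by
  have hX := excess_nonneg d (graphOf l) 1
  have hW : (0 : ℝ) ≤ (unsatPairs d (graphOf l)).card := Nat.cast_nonneg _
  have hI : (0 : ℝ) ≤ (settled d n t).indicator 1 l := Set.indicator_nonneg (by simp) l
  by_cases h1 : HasUnsaturatedEdge d (graphOf l)
  · rw [hasUnsaturatedEdge_iff] at h1
    have : (1 : ℝ) ≤ (unsatPairs d (graphOf l)).card := by exact_mod_cast h1.card_pos
    linarith
  by_cases h2 : ∀ v, free d (graphOf l) v ≤ 1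
  · have hmem : l ∈ settled d n t := by
      refine ⟨fun s hs hdef => ?_, h2, h1⟩
      rcases hs.lt_or_eq with hs | rfl
      -- Proper prefixes have deficit greater than `t`, so they impose no condition.
      · obtain ⟨j, hj⟩ := reachable_take hl s hs.le
        rw [deficit_of_reachable hj, List.length_take_of_le hs.le] at hdef
        rw [length_of_reachable hd hl hk] at hs
        omega
      · rwa [List.take_length]
    rw [Set.indicator_of_mem hmem, Pi.one_apply]
    linarith
  · push Not at h2
    obtain ⟨v, hv⟩ := h2
    have h3 := Finset.single_le_sum (f := fun v => ((free d (graphOf l) v - 1 : ℕ) : ℝ))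
      (fun v _ => Nat.cast_nonneg _) (Finset.mem_univ v)
    have h4 : (1 : ℝ) ≤ ((free d (graphOf l) v - 1 : ℕ) : ℝ) := by
      exact_mod_cast Nat.le_sub_of_add_le hv
    have h5 : (1 : ℝ) ≤ excess d (graphOf l) 1 := h4.trans h3
    linarith

theorem one_sub_le_runMean_settled {d t k : ℕ} (hd : 2 ≤ d)
    (hk : 8 * (d : ℝ) ^ 2 ≤ d * n - 2 * k) (ht : k + t ≤ d * n / 2) :
    1 - (runMean d n k (fun l => excess d (graphOf l) 1) +
      runMean d n k (fun l => ((unsatPairs d (graphOf l)).card : ℝ))) ≤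
      runMean d n (d * n / 2) ((noUnsaturatedEdgeFrom d n t).indicator 1) := by
  have h1 := runMean_mono (d := d) (n := n) fun l hl => one_sub_le_indicator_settled hd hk ht hl
  have h2 : runMean d n k ((settled d n t).indicator 1) ≤
      runMean d n (d * n / 2) ((settled d n t).indicator 1) :=
    runMean_settled_mono (by omega)
  have h3 : runMean d n (d * n / 2) ((settled d n t).indicator 1) ≤
      runMean d n (d * n / 2) ((noUnsaturatedEdgeFrom d n t).indicator 1) :=
    runMean_mono fun l _ => Set.indicator_le_indicator_of_subset (fun l hl => hl.1)
      (fun _ => zero_le_one) l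
  refine le_trans (le_of_eq ?_) (h1.trans (h2.trans h3))
  have h4 := runMean_linear d k 1 1 (fun l : List (Sym2 (Fin n)) => excess d (graphOf l) 1)
    (fun l => ((unsatPairs d (graphOf l)).card : ℝ))
  have h5 := runMean_linear d k (-1) 1
    (fun l : List (Sym2 (Fin n)) => 1 * excess d (graphOf l) 1 +
      1 * ((unsatPairs d (graphOf l)).card : ℝ)) (fun _ => 1)
  rw [h4, runMean_const] at h5
  have h6 : (fun l : List (Sym2 (Fin n)) => (1 : ℝ) - (excess d (graphOf l) 1 +
      (unsatPairs d (graphOf l)).card)) = fun l => -1 * (1 * excess d (graphOf l) 1 +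
      1 * ((unsatPairs d (graphOf l)).card : ℝ)) + 1 * 1 := by
    funext l; ring
  rw [h6, h5]
  ring

/-! ### The quantitative bound for fixed `n` -/

/-- The source of the gain `1 / log n`: `beta k` has degree `k - 1` and `alpha k` has degree `k`.
The argument `9 * T` is `H + T` for `H = 8 * T`. -/
theorem upperSum_le_lowerSum (d : ℕ) {T : ℝ} (hT : 0 < T) (G : SimpleGraph (Fin n)) :
    upperSum d (9 * T) G ≤ 2 * 18 ^ d * d.factorial / T * lowerSum d T G := by
  rw [upperSum, lowerSum, Finset.mul_sum]
  refine Finset.sum_le_sum fun k hk => ?_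
  rw [← mul_assoc]
  refine mul_le_mul_of_nonneg_right ?_ (excess_nonneg d G k)
  cases k with
  | zero => simp only [beta, alpha_zero]; positivity
  | succ k =>
    have hk' : k + 1 ≤ d := (Finset.mem_range.1 hk).le
    simp only [beta, alpha]
    have h1 : (18 : ℝ) ^ k ≤ 18 ^ d := pow_le_pow_right₀ (by norm_num) (by omega)
    have h2 : ((k + 1).factorial : ℝ) ≤ d.factorial := by
      exact_mod_cast Nat.factorial_le hk'
    have h3 : (18 : ℝ) ^ k * (k + 1).factorial ≤ 18 ^ d * d.factorial :=
      mul_le_mul h1 h2 (by positivity) (by positivity)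
    have h4 : (9 * T) ^ k = 18 ^ k * (T / 2) ^ k := by rw [← mul_pow]; ring_nf
    have h5 : 2 * 18 ^ d * d.factorial / T * ((T / 2) ^ (k + 1) / (k + 1).factorial) =
        18 ^ d * d.factorial * (T / 2) ^ k / (k + 1).factorial := by
      rw [pow_succ]; field_simp
    rw [h4, h5, le_div_iff₀ (by positivity)]
    calc (18 : ℝ) ^ k * (T / 2) ^ k * (k + 1).factorial
        = 18 ^ k * (k + 1).factorial * (T / 2) ^ k := by ring
      _ ≤ _ := mul_le_mul_of_nonneg_right h3 (by positivity)

theorem potential_nil_le {d : ℕ} (hd : 2 ≤ d) (hn : 0 < n) {T : ℝ} (hT : 2 ≤ T) :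
    potential (n := n) d (8 * T) T [] ≤ d * (2 * 18 ^ d * d.factorial / T) := by
  have hcl : clock (n := n) d [] = 0 := by simp [clock]
  rw [potential, hcl, sub_zero, if_pos hT]
  refine mul_le_mul_of_nonneg_left ?_ (Nat.cast_nonneg _)
  have h1 := excess_zero_le_lowerSum hd (by linarith : 0 ≤ T)
    (graphOf ([] : List (Sym2 (Fin n))))
  have h2 := excess_zero_of_reachable (d := d) (k := 0) (l := ([] : List (Sym2 (Fin n)))) rfl
  have h3 : (0 : ℝ) < d * n := by positivity
  simp only [List.length_nil, Nat.cast_zero, mul_zero, sub_zero] at h2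
  rw [div_le_iff₀ (by linarith), show 8 * T + T = 9 * T by ring]
  exact upperSum_le_lowerSum d (by linarith) _

/-- A bound on the probability of failure. -/
noncomputable def failureBound (d : ℕ) (T x : ℝ) : ℝ :=
  (2 + 40 * d ^ 2) * x *
      (d * (2 * 18 ^ d * d.factorial / T) + 16 * d ^ 6 * ((9 * T) ^ d) ^ 3 * Real.exp (-T))
    + d * x ^ 2 * Real.exp (-T)

theorem one_sub_failureBound_le {d t : ℕ} (hd : 2 ≤ d) (hdn : d ≤ n) {T : ℝ}
    (hT : T = Real.log n / 4) (hT2 : 2 ≤ T) (ht : 4 * d ^ 2 ≤ t) (htT : 2 * (t : ℝ) + 1 ≤ 9 * T) :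
    1 - failureBound d T (2 * t + 1) ≤
      runMean d n (d * n / 2) ((noUnsaturatedEdgeFrom d n t).indicator 1) := by
  have hd' : (2 : ℝ) ≤ d := by exact_mod_cast hd
  have hn0 : 0 < n := by omega
  have hn : (n : ℝ) = Real.exp (4 * T) := by
    rw [hT, mul_div_cancel₀ _ (by norm_num), Real.exp_log (by exact_mod_cast hn0)]
  -- Here `Q = n ^ (3 / 4)`, so the errors of up to order `n` steps, each `polylog / Q ^ 2`, still
  -- sum to a negligible amount.
  set Q : ℝ := Real.exp (3 * T) with hQdef
  have hQ : Q = n * Real.exp (-T) := by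
    rw [hn, ← Real.exp_add, hQdef]
    congr 1
    ring
  have hQT : 1 + 3 * T + (3 * T) ^ 2 / 2 ≤ Q :=
    Real.quadratic_le_exp_of_nonneg (by linarith)
  have hQ9 : 9 * T + 2 ≤ 2 * Q - 2 := by nlinarith
  have hQn : Q ≤ n := by
    rw [hQ]; exact mul_le_of_le_one_right (Nat.cast_nonneg _) (Real.exp_le_one_iff.2 (by linarith))
  have hdQ : 2 * Q ≤ d * Q := mul_le_mul_of_nonneg_right hd' (Real.exp_pos _).le
  have hdQn : d * Q ≤ d * n := mul_le_mul_of_nonneg_left hQn (by linarith)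
  have hmod := Nat.div_add_mod (d * n) 2
  have hmod2 := Nat.mod_lt (d * n) (show 0 < 2 by norm_num)
  have htn : t ≤ d * n / 2 := by
    have : (2 : ℝ) * t ≤ d * n := by linarith
    have : 2 * t ≤ d * n := by exact_mod_cast this
    omega
  obtain ⟨k, hk⟩ : ∃ k, k + t = d * n / 2 := ⟨d * n / 2 - t, by omega⟩
  have hD1 : 2 * (t : ℝ) ≤ d * n - 2 * k := by
    have : 2 * t + 2 * k ≤ d * n := by omega
    have : (2 : ℝ) * t + 2 * k ≤ d * n := by exact_mod_cast this
    linarith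
  have hD2 : d * n - 2 * (k : ℝ) ≤ 2 * t + 1 := by
    have : d * n ≤ 2 * t + 2 * k + 1 := by omega
    have : (d : ℝ) * n ≤ 2 * t + 2 * k + 1 := by exact_mod_cast this
    linarith
  have hD8 : 8 * (d : ℝ) ^ 2 ≤ d * n - 2 * k := by
    have : 4 * (d : ℝ) ^ 2 ≤ t := by exact_mod_cast ht
    linarith
  refine le_trans ?_ (one_sub_le_runMean_settled hd hD8 hk.le)
  have hH : Real.log (d * n) ≤ 8 * T := by
    rw [Real.log_mul (by linarith) (by exact_mod_cast hn0.ne')]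
    have : Real.log d ≤ Real.log n :=
      Real.log_le_log (by linarith) (by exact_mod_cast hdn)
    linarith
  set κ : ℝ := d * (2 * 18 ^ d * d.factorial / T)
    + 16 * d ^ 6 * ((9 * T) ^ d) ^ 3 * Real.exp (-T) with hκ
  have hκ0 : 0 ≤ κ := by positivity
  have hexc : ∀ j ≤ k, d * n - 2 * (j : ℝ) ≤ d * Q →
      runMean d n j (fun l => excess d (graphOf l) 1) ≤ 2 * (d * n - 2 * j) * κ := by
    intro j hj hjQ
    have hj' : (j : ℝ) ≤ k := by exact_mod_cast hj
    have h1 := runMean_excess_one_le hd (k := j) (by linarith) hH (by linarith) (by linarith)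
      (by linarith : 1 ≤ Q) hQ.le (by rw [hQ, ← mul_assoc] at hjQ; exact hjQ)
    refine h1.trans (mul_le_mul_of_nonneg_left ?_ (by linarith [Nat.cast_nonneg (α := ℝ) t]))
    rw [hκ]
    refine add_le_add (potential_nil_le hd hn0 hT2) ?_
    rw [show 8 * T + T = 9 * T by ring]
    have h2 : (j : ℝ) ≤ d * n := by linarith [Nat.cast_nonneg (α := ℝ) t]
    refine (mul_le_mul_of_nonneg_right h2 (by positivity)).trans ?_
    have h3 : (n : ℝ) / Q ^ 2 ≤ Real.exp (-T) := by
      rw [hn, hQdef, ← Real.exp_nat_mul, ← Real.exp_sub, Real.exp_le_exp]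
      push_cast; linarith
    calc (d : ℝ) * n * (16 * d ^ 5 * ((9 * T) ^ d) ^ 3 / Q ^ 2)
        = 16 * d ^ 6 * ((9 * T) ^ d) ^ 3 * (n / Q ^ 2) := by ring
      _ ≤ _ := mul_le_mul_of_nonneg_left h3 (by positivity)
  have hX := hexc k le_rfl (by linarith)
  -- The first step at which at most `d * n * exp (-T)` free places are left, from where the bound
  -- on `excess 1` is available.
  set k₁ : ℕ := ⌈(d * n - d * Q) / 2⌉₊ with hk₁def
  have hk₁a : (d * n - d * Q) / 2 ≤ k₁ := Nat.le_ceil _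
  have hk₁b : (k₁ : ℝ) < (d * n - d * Q) / 2 + 1 := Nat.ceil_lt_add_one (by linarith)
  have hk₁ : k₁ ≤ k := by
    rw [hk₁def, Nat.ceil_le]
    linarith
  have hW := runMean_card_unsatPairs_le hd hk₁ (κ := κ) hD8 fun j hj hjk =>
    hexc j hjk (by
      have : (k₁ : ℝ) ≤ j := by exact_mod_cast hj
      linarith)
  set D : ℝ := d * n - 2 * k
  set x : ℝ := 2 * t + 1 with hx
  have hx1 : 1 ≤ x := by linarith [Nat.cast_nonneg (α := ℝ) t]
  have hD0 : 0 ≤ D := by linarith [Nat.cast_nonneg (α := ℝ) t]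
  have hsq : Real.exp T ≤ √(d * n - 2 * k₁) := by
    refine Real.le_sqrt_of_sq_le ?_
    rw [← Real.exp_nat_mul]
    have : Real.exp ((2 : ℕ) * T) ≤ Q := Real.exp_le_exp.2 (by push_cast; linarith)
    linarith
  have h1 : d / √(d * n - 2 * k₁) * (D * √D) ≤ d * x ^ 2 * Real.exp (-T) := by
    have h2 : d / √(d * n - 2 * k₁) ≤ d * Real.exp (-T) := by
      rw [Real.exp_neg, ← div_eq_mul_inv]
      exact div_le_div_of_nonneg_left (by linarith) (Real.exp_pos _) hsq
    have h3 : √D ≤ x := by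
      rw [Real.sqrt_le_iff]
      exact ⟨by linarith, by nlinarith⟩
    have h4 : D * √D ≤ x * x := mul_le_mul hD2 h3 (Real.sqrt_nonneg _) (by linarith)
    calc _ ≤ d * Real.exp (-T) * (x * x) :=
          mul_le_mul h2 h4 (by positivity) (by positivity)
      _ = _ := by ring
  have h5 : (2 + 40 * (d : ℝ) ^ 2) * D * κ ≤ (2 + 40 * d ^ 2) * x * κ :=
    mul_le_mul_of_nonneg_right (mul_le_mul_of_nonneg_left hD2 (by positivity)) hκ0
  rw [failureBound, ← hκ]
  linarith

end

/-! ### The limit -/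

section

open Filter Topology

theorem runMean_indicator_le_one {n : ℕ} (d k : ℕ) (S : Set (List (Sym2 (Fin n)))) :
    runMean d n k (S.indicator 1) ≤ 1 := by
  refine (runMean_mono (g := fun _ => 1) fun l _ => ?_).trans (runMean_const d k 1).le
  by_cases hl : l ∈ S <;> simp [hl]

theorem failureBound_mono (d : ℕ) {T x y : ℝ} (hT : 0 < T) (hx : 0 ≤ x) (hxy : x ≤ y) :
    failureBound d T x ≤ failureBound d T y := by
  unfold failureBound
  gcongr

/-- Only the term with `1 / T` needs `y` to be sublinear; the others decay exponentially. -/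
theorem tendsto_failureBound (d : ℕ) {y : ℝ → ℝ}
    (hy : Tendsto (fun T => y T / T) atTop (𝓝 0)) :
    Tendsto (fun T => failureBound d T (y T)) atTop (𝓝 0) := by
  have h1 := (tendsto_const_nhds (x := (2 + 40 * (d : ℝ) ^ 2) * (d * (2 * 18 ^ d * d.factorial)))
    (f := atTop (α := ℝ))).mul hy
  have h2 := (tendsto_const_nhds (x := (2 + 40 * (d : ℝ) ^ 2) * (16 * d ^ 6 * (9 ^ d) ^ 3))
    (f := atTop (α := ℝ))).mul
    (hy.mul (Real.tendsto_pow_mul_exp_neg_atTop_nhds_zero (d * 3 + 1)))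
  have h3 := (tendsto_const_nhds (x := (d : ℝ)) (f := atTop (α := ℝ))).mul
    ((hy.mul hy).mul (Real.tendsto_pow_mul_exp_neg_atTop_nhds_zero 2))
  have h := (h1.add h2).add h3
  simp only [mul_zero, add_zero] at h
  refine h.congr' ?_
  filter_upwards [eventually_gt_atTop 0] with T hT
  unfold failureBound
  rw [mul_pow, mul_pow, ← pow_mul T, pow_succ T]
  field_simp

theorem noUnsaturatedEdgeFrom_anti (d n : ℕ) {s t : ℕ} (hst : s ≤ t) :
    noUnsaturatedEdgeFrom d n t ⊆ noUnsaturatedEdgeFrom d n s :=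
  fun _ hl i hi hdef => hl i hi (hdef.trans hst)

theorem tendsto_runMean_noUnsaturatedEdgeFrom {d : ℕ} (hd : 2 ≤ d) {δ : ℝ} (hδ : 0 < δ)
    (hδ1 : δ < 1) :
    Tendsto (fun n : ℕ => runMean d n (d * n / 2)
      ((noUnsaturatedEdgeFrom d n ⌊Real.log n ^ (1 - δ)⌋₊).indicator 1)) atTop (𝓝 1) := by
  -- An upper bound for `2 * t + 1` in terms of `T`, as `log n = 4 * T`.
  set y : ℝ → ℝ := fun T => 2 * (4 * T) ^ (1 - δ) + 1 with hy
  have h4T : Tendsto (fun T : ℝ => 4 * T) atTop atTop :=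
    tendsto_id.const_mul_atTop (by norm_num)
  have hyT : Tendsto (fun T => y T / T) atTop (𝓝 0) := by
    have h1 := ((tendsto_rpow_neg_atTop hδ).comp h4T).const_mul 8
    have h2 := h1.add tendsto_inv_atTop_zero
    simp only [mul_zero, add_zero] at h2
    refine h2.congr' ?_
    filter_upwards [eventually_gt_atTop 0] with T hT
    have h3 : (4 * T) ^ (1 - δ) = 4 * T * (4 * T) ^ (-δ) := by
      rw [sub_eq_add_neg, Real.rpow_add (by positivity), Real.rpow_one]
    simp only [hy, Function.comp_apply, h3]
    field_simp
    ring
  have hlog : Tendsto (fun n : ℕ => Real.log n) atTop atTop :=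
    Real.tendsto_log_atTop.comp tendsto_natCast_atTop_atTop
  have hT : Tendsto (fun n : ℕ => Real.log n / 4) atTop atTop :=
    hlog.atTop_div_const (by norm_num)
  have hfail := (tendsto_failureBound d hyT).comp hT
  have hlow := (tendsto_const_nhds (x := (1 : ℝ)) (f := atTop (α := ℕ))).sub hfail
  rw [sub_zero] at hlow
  have htend : Tendsto (fun n : ℕ => ⌊Real.log n ^ (1 - δ)⌋₊) atTop atTop :=
    tendsto_nat_floor_atTop.comp ((tendsto_rpow_atTop (by linarith)).comp hlog)
  refine tendsto_of_tendsto_of_tendsto_of_le_of_le' hlow tendsto_const_nhds ?_ ?_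
  · filter_upwards [eventually_ge_atTop d, hT.eventually_ge_atTop 2,
      htend.eventually_ge_atTop (4 * d ^ 2), (hyT.comp hT).eventually_le_const zero_lt_one]
      with n hdn hT2 ht hyn
    have hTpos : 0 < Real.log n / 4 := by linarith
    have ht0 : (⌊Real.log n ^ (1 - δ)⌋₊ : ℝ) ≤ Real.log n ^ (1 - δ) :=
      Nat.floor_le (Real.rpow_nonneg (by linarith) _)
    have hty : 2 * (⌊Real.log n ^ (1 - δ)⌋₊ : ℝ) + 1 ≤ y (Real.log n / 4) := by
      simp only [hy, mul_div_cancel₀ (Real.log n) (by norm_num : (4 : ℝ) ≠ 0)]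
      linarith
    have hy9 : y (Real.log n / 4) ≤ 9 * (Real.log n / 4) := by
      rw [Function.comp_apply, div_le_one hTpos] at hyn
      linarith
    have h5 := one_sub_failureBound_le hd hdn rfl hT2 ht (hty.trans hy9)
    refine le_trans ?_ h5
    exact sub_le_sub_left (failureBound_mono d hTpos (by positivity) hty) 1
  · filter_upwards with n
    exact runMean_indicator_le_one d _ _

end

end BoundedDegree

theorem corollary6p4 (d : ℕ) (hd : 2 ≤ d) (ε : ℝ) (hε : 0 < ε) :
    Filter.Tendsto
      (fun n : ℕ => (BoundedDegree.edgeSequence d n).toOuterMeasure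
        (BoundedDegree.noUnsaturatedEdgeFrom d n ⌊Real.log n ^ (1 - ε)⌋₊))
      Filter.atTop (nhds 1) := by
  -- Capping the exponent's `ε` at `1 / 2` makes the deficit tend to infinity, beyond the threshold
  -- `4 * d ^ 2`. A larger deficit gives a smaller event, so the original `ε` follows.
  have h1 := BoundedDegree.tendsto_runMean_noUnsaturatedEdgeFrom hd (δ := min ε (1 / 2))
    (lt_min hε (by norm_num)) (lt_of_le_of_lt (min_le_right _ _) (by norm_num))
  have h2 := ENNReal.tendsto_ofReal h1
  rw [ENNReal.ofReal_one] at h2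
  refine tendsto_of_tendsto_of_tendsto_of_le_of_le' h2 tendsto_const_nhds ?_ ?_
  · have hlog : Filter.Tendsto (fun n : ℕ => Real.log n) Filter.atTop Filter.atTop :=
      Real.tendsto_log_atTop.comp tendsto_natCast_atTop_atTop
    filter_upwards [hlog.eventually_ge_atTop 1] with n hn
    rw [← BoundedDegree.toOuterMeasure_run]
    refine MeasureTheory.measure_mono (BoundedDegree.noUnsaturatedEdgeFrom_anti d n ?_)
    refine Nat.floor_le_floor (Real.rpow_le_rpow_of_exponent_le hn ?_)
    linarith [min_le_left ε (1 / 2)]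
  · filter_upwards with n
    rw [BoundedDegree.edgeSequence, BoundedDegree.toOuterMeasure_run, ← ENNReal.ofReal_one]
    exact ENNReal.ofReal_le_ofReal (BoundedDegree.runMean_indicator_le_one d _ _)
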